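/- Write $\mathbb{C}\ni z=x+iy=(x,y,0)\in\mathbb{R}^3$, let $H^+=\{z\in\mathbb{C}:\operatorname{Re} z\ge 0\}$, and for $t\in[0,2\pi)$ let $\sigma_t(x,y,\zeta)=(x\cos t-\zeta\sin t,\;y,\;x\sin t+\zeta\cos t)$ be the rotation of $\mathbb{R}^3$ about the $y$-axis. For $A\subset H^+$ put $\Gamma(A)=\{\sigma_t(z): z\in A,\ 0\le t<2\pi\}$. For $z,w\in H^+$ let $$K(z,w)=\frac1{2\pi}\int_0^{2\pi}\log\frac{1}{|\sigma_t(z)-w|}\,dt\in(-\infty,+\infty],$$ which is $+\infty$ only when $z=w$ lies on the $y$-axis. For a non-empty compact set $A\subset H^+$ let $$A_+=\{x+iy\in A:\ x=\max\{x' : x'+iy\in A\}\}.$$ A logarithmic equilibrium measure on a compact set $B\subset\mathbb{R}^3$ is a Borel probability measure $\mu$ supported on $B$ that minimizes $I_0(\mu)=\iint\log\frac1{|p-q|}\,d\mu(p)\,d\mu(q)$ among all Borel probability measures supported on $B$. When there is exactly one, it is denoted by $\mu_B$. **Theorem.** Let $A\subset H^+$ be a non-empty compact set such that $A_+$ is contained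 in the interior of $H^+$, and let $\gamma:[a,b]\to H^+$ be continuous. Suppose that (a) $A_+\subset\gamma([a,b])$, and (b) for each fixed $s\in[a,b]$ the function $t\mapsto K(\gamma(t),\gamma(s))$ is strictly convex on $[a,s]$ and on $[s,b]$, where $f$ is strictly convex on an interval if $f(\theta x+(1-\theta)y)<\theta f(x)+(1-\theta)f(y)$ for all $x<y$ in the interval and all $0<\theta<1$. Then $\Gamma(A)$ has exactly one logarithmic equilibrium measure $\mu_{\Gamma(A)}$, and the Borel probability measure $\lambda_A$ on $H^+$ defined by $\lambda_A(B)=\mu_{\Gamma(A)}(\Gamma(B))$ satisfies $$\operatorname{supp}\lambda_A=\gamma(I)\cap A_+$$ for some non-empty closed interval $I=[c,d]\subset[a,b]$ (possibly with $c=d$). -/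

import Mathlib

open Set MeasureTheory

noncomputable section

namespace Revolution

/-- Three-dimensional Euclidean space, with coordinates `p 0, p 1, p 2` playing the roles of
`x, y, ζ`; the axis of revolution is the `y`-axis. -/
abbrev Space : Type := EuclideanSpace ℝ (Fin 3)

/-- The integral of an extended-real-valued function, as the integral of its positive part
minus that of its negative part. It has its usual meaning when one of the two is finite, as
for functions bounded below and finite measures. -/
def extIntegral {α : Type*} [MeasurableSpace α] (μ : Measure α) (f : α → EReal) : EReal :=
  ((∫⁻ x, (f x).toENNReal ∂μ : ENNReal) : EReal) -
    ((∫⁻ x, (-f x).toENNReal ∂μ : ENNReal) : EReal)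

/-! ### Logarithmic energy and equilibrium measures in space -/

/-- The logarithmic kernel `log (1 / |p - q|)`, equal to `+∞` when `p = q`. -/
def logKernel (p q : Space) : EReal := -ENNReal.log (edist p q)

/-- The Borel probability measures supported on `B`. -/
def probOn (B : Set Space) : Set (Measure Space) :=
  {μ | IsProbabilityMeasure μ ∧ μ Bᶜ = 0}

/-- The logarithmic energy `∬ log (1 / |p - q|) dμ(p) dμ(q)`. -/
def logEnergy (μ : Measure Space) : EReal :=
  extIntegral (μ.prod μ) fun pq => logKernel pq.1 pq.2

/-- The minimal logarithmic energy of the probability measures on `B`. -/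
def minLogEnergy (B : Set Space) : EReal := ⨅ μ ∈ probOn B, logEnergy μ

/-- `μ` is a probability measure on `B` of least logarithmic energy. -/
def IsLogEquilibriumMeasure (B : Set Space) (μ : Measure Space) : Prop :=
  μ ∈ probOn B ∧ logEnergy μ = minLogEnergy B

open Classical in
/-- The logarithmic equilibrium measure of `B` (the zero measure if there is none). -/
def logEquilibriumMeasure (B : Set Space) : Measure Space :=
  if h : ∃ μ, IsLogEquilibriumMeasure B μ then h.choose else 0

/-! ### Sets of revolution -/

/-- The closed right half-plane, points `(x, y)` being written as complex numbers `x + iy`. -/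
def rightHalfPlane : Set ℂ := {z | 0 ≤ z.re}

/-- The point `(x, y, 0)` of space corresponding to `x + iy`. -/
def toSpace (z : ℂ) : Space := !₂[z.re, z.im, 0]

/-- The rotation about the `y`-axis through the angle `t`. -/
def rot (t : ℝ) (p : Space) : Space :=
  !₂[p 0 * Real.cos t - p 2 * Real.sin t, p 1, p 0 * Real.sin t + p 2 * Real.cos t]

/-- The set obtained by revolving `A` around the `y`-axis. -/
def revolve (A : Set ℂ) : Set Space :=
  {p | ∃ z ∈ A, ∃ t ∈ Ico 0 (2 * Real.pi), p = rot t (toSpace z)}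

/-- The point of the half-plane whose orbit under the rotations contains `p`. -/
def profile (p : Space) : ℂ := ⟨Real.sqrt (p 0 ^ 2 + p 2 ^ 2), p 1⟩

/-- The measure induced on the half-plane by the logarithmic equilibrium measure of the set
of revolution of `A`; by `equilibriumMeasure_apply` it gives a Borel set `B` of the half-plane
the mass of `revolve B`. -/
def equilibriumMeasure (A : Set ℂ) : Measure ℂ :=
  (logEquilibriumMeasure (revolve A)).map profile

lemma profile_rot_toSpace {z : ℂ} (hz : z ∈ rightHalfPlane) (t : ℝ) :
    profile (rot t (toSpace z)) = z := by
  have h0 : (0 : ℝ) ≤ z.re := hz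
  apply Complex.ext
  · have h : (z.re * Real.cos t) ^ 2 + (z.re * Real.sin t) ^ 2 = z.re ^ 2 := by
      have := Real.sin_sq_add_cos_sq t
      linear_combination z.re ^ 2 * this
    simp [profile, rot, toSpace, h, Real.sqrt_sq h0]
  · simp [profile, rot, toSpace]

lemma exists_rot_profile (p : Space) :
    ∃ t ∈ Ico 0 (2 * Real.pi), p = rot t (toSpace (profile p)) := by
  set w : ℂ := ⟨p 0, p 2⟩ with hw
  have hn : Real.sqrt (p 0 ^ 2 + p 2 ^ 2) = ‖w‖ := by
    rw [Complex.norm_def, Complex.normSq_apply]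
    simp [hw, sq]
  have hpi : 0 < 2 * Real.pi := by positivity
  refine ⟨toIcoMod hpi 0 w.arg, by simpa using toIcoMod_mem_Ico hpi 0 w.arg, ?_⟩
  have hc : Real.cos (toIcoMod hpi 0 w.arg) = Real.cos w.arg := by
    rw [toIcoMod, zsmul_eq_mul, Real.cos_sub_int_mul_two_pi]
  have hs : Real.sin (toIcoMod hpi 0 w.arg) = Real.sin w.arg := by
    rw [toIcoMod, zsmul_eq_mul, Real.sin_sub_int_mul_two_pi]
  have h1 := Complex.norm_mul_cos_arg w
  have h2 := Complex.norm_mul_sin_arg w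
  ext i
  fin_cases i
  · simp [rot, toSpace, profile, hc, hn, h1]
    simp [hw]
  · simp [rot, toSpace, profile]
  · simp [rot, toSpace, profile, hs, hn, h2]
    simp [hw]

lemma measurable_profile : Measurable profile := by
  have h : Continuous profile := by
    have : profile = fun p : Space =>
        ((Real.sqrt (p 0 ^ 2 + p 2 ^ 2) : ℝ) : ℂ) + ((p 1 : ℝ) : ℂ) * Complex.I := by
      funext p
      apply Complex.ext <;> simp [profile]
    rw [this]
    fun_prop
  exact h.measurable

lemma profile_preimage {B : Set ℂ} (hB : B ⊆ rightHalfPlane) : profile ⁻¹' B = revolve B := by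
  ext p
  constructor
  · intro hp
    obtain ⟨t, ht, h⟩ := exists_rot_profile p
    exact ⟨profile p, hp, t, ht, h⟩
  · rintro ⟨z, hz, t, -, rfl⟩
    simpa [profile_rot_toSpace (hB hz) t] using hz

lemma equilibriumMeasure_apply (A : Set ℂ) {B : Set ℂ} (hB : B ⊆ rightHalfPlane)
    (hm : MeasurableSet B) :
    equilibriumMeasure A B = logEquilibriumMeasure (revolve A) (revolve B) := by
  rw [equilibriumMeasure, Measure.map_apply measurable_profile hm, profile_preimage hB]

/-! ### The kernel in the half-plane, right-most parts, strict convexity -/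

/-- The rotational average `K(z, w) = (1 / 2π) ∫_0^{2π} log (1 / |σ_t(z) - w|) dt` of the
logarithmic kernel. It is finite unless `z = w` is on the axis, where it is `+∞`. -/
def K (z w : ℂ) : EReal :=
  (((2 * Real.pi)⁻¹ : ℝ) : EReal) *
    extIntegral (volume.restrict (Ico (0 : ℝ) (2 * Real.pi)))
      fun t => logKernel (rot t (toSpace z)) (toSpace w)

/-- The right-most part of `A`: the points `x + iy` for which `x` is the largest number with
`x + iy ∈ A`. -/
def rightmost (A : Set ℂ) : Set ℂ :=
  {z | IsGreatest {x : ℝ | (⟨x, z.im⟩ : ℂ) ∈ A} z.re}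

/-- Strict convexity on the interval `[a, b]` of a function with values in `(-∞, +∞]`. -/
def StrictlyConvexOnIcc (f : ℝ → EReal) (a b : ℝ) : Prop :=
  ∀ x y θ : ℝ, a ≤ x → x < y → y ≤ b → 0 < θ → θ < 1 →
    f (θ * x + (1 - θ) * y) < (θ : EReal) * f x + ((1 - θ : ℝ) : EReal) * f y

end Revolution

end

namespace Revolution

/-! ### Extended integrals of functions bounded below -/

/-! The logarithmic kernel is handled through its Gaussian representation log (R/r) = ∫_0^∞ (exp (-s
r²) - exp (-s R²)) / (2s) ds, valid for 0 ≤ r ≤ R (`shiftedLog_eq_lintegral`). Each Gaussian is the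
characteristic function of a normal law, so the energy is a superposition of weighted L² norms of
the characteristic function of the measure. Weak compactness and Fatou then give a minimizer
(`exists_minimizer_shiftedEnergy`), and the parallelogram law makes it unique as soon as the minimum
is finite (`minimizer_shiftedEnergy_unique`). Finiteness comes from a circle in the set of
revolution lying off the axis.

Uniqueness makes the minimizer rotation invariant, so its profile minimizes the energy of the
averaged kernel on A. This kernel is explicit: the distances between points of two circles of
revolution are those between two concentric planar circles, and the circle mean of log |· - a| gives
K(z,w) = -log `meanDist z w` (`lintegral_shiftedLog_rot`).

Let F be the minimal energy and U the potential of the minimizing profile. Variation by point masses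
gives F ≤ U on A, and lower semicontinuity of U gives U ≤ F on the support. Moving a point to the
right never increases U, and does so strictly from a support point; hence the support lies in A₊
(`support_subset_rightmost`). If the support left a gap (α,β) in the parameter interval containing
some t with γ(t) ∈ A₊, every kernel K(γ(·), γ(s)) with γ(s) in the support would be strictly convex
on [α,β]. Integrating, U(γ(t)) would be strictly less than a convex combination of values of U that
are at most F, contradicting F ≤ U (`exists_support_eq`). -/

lemma EReal_sub_eq_of_add_eq {a b c : ENNReal} {m : ℝ} (hm : 0 ≤ m) (hb : b ≠ ⊤)
    (h : a + b = c + ENNReal.ofReal m) :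
    (c : EReal) - (b : EReal) = (a : EReal) - (m : EReal) := by
  induction b with
  | top => exact absurd rfl hb
  | coe b =>
    induction c with
    | top =>
      have ha : a = ⊤ := by
        by_contra ha
        have h1 : a + (b : ENNReal) ≠ ⊤ := ENNReal.add_ne_top.2 ⟨ha, ENNReal.coe_ne_top⟩
        rw [h] at h1
        simp at h1
      subst ha
      simp
    | coe c =>
      have ha : a ≠ ⊤ := by
        rintro rfl
        simp at h
        exact ENNReal.add_ne_top.2 ⟨ENNReal.coe_ne_top, ENNReal.ofReal_ne_top⟩ h.symm
      lift a to NNReal using ha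
      have h2 := congrArg ENNReal.toReal h
      rw [ENNReal.toReal_add (by simp) (by simp), ENNReal.toReal_add (by simp) (by simp),
        ENNReal.toReal_ofReal hm] at h2
      simp only [ENNReal.coe_toReal] at h2
      have h3 : (c : ℝ) - b = a - m := by linarith
      simp only [EReal.coe_nnreal_eq_coe_real]
      rw [← EReal.coe_sub, ← EReal.coe_sub, h3]

/-- The integral of a function that is bounded below is computed by shifting the function. -/
lemma extIntegral_eq_of_ae_eq_sub {α : Type*} [MeasurableSpace α] {μ : Measure α}
    [IsFiniteMeasure μ] {f : α → EReal} {g : α → ENNReal} (hg : AEMeasurable g μ) {m : ℝ}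
    (hm : 0 ≤ m) (hf : ∀ᵐ x ∂μ, f x = (g x : EReal) - (m : EReal)) :
    extIntegral μ f = ((∫⁻ x, g x ∂μ : ENNReal) : EReal) - ((m * μ.real univ : ℝ) : EReal) := by
  -- Comparing positive and negative parts by an identity without outer subtraction keeps it valid
  -- for y = `⊤`, so no integrability of g is needed.
  have key : ∀ y : ENNReal, y + ((m : EReal) - y).toENNReal
      = ((y : EReal) - m).toENNReal + ENNReal.ofReal m := by
    intro y
    induction y with
    | top => simp
    | coe y =>
      simp only [EReal.coe_nnreal_eq_coe_real]
      rw [← EReal.coe_sub, ← EReal.coe_sub, EReal.toENNReal_of_ne_top (EReal.coe_ne_top _),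
        EReal.toENNReal_of_ne_top (EReal.coe_ne_top _), EReal.toReal_coe, EReal.toReal_coe]
      have hy : (y : ENNReal) = ENNReal.ofReal y := by simp
      rw [hy]
      rcases le_total (y : ℝ) m with h | h
      · rw [ENNReal.ofReal_of_nonpos (sub_nonpos.2 h), zero_add,
          ← ENNReal.ofReal_add y.coe_nonneg (by linarith)]
        congr 1; ring
      · rw [ENNReal.ofReal_of_nonpos (sub_nonpos.2 h), add_zero,
          ← ENNReal.ofReal_add (by linarith) hm]
        congr 1; ring
  have h1 : (∫⁻ x, (f x).toENNReal ∂μ) = ∫⁻ x, ((g x : EReal) - m).toENNReal ∂μ :=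
    lintegral_congr_ae (hf.mono fun x hx => by simp only [hx])
  have h2 : (∫⁻ x, (-f x).toENNReal ∂μ) = ∫⁻ x, ((m : EReal) - g x).toENNReal ∂μ :=
    lintegral_congr_ae (hf.mono fun x hx => by
      simp only [hx]
      rw [EReal.neg_sub (by simp) (by simp), sub_eq_add_neg, add_comm])
  rw [extIntegral, h1, h2]
  apply EReal_sub_eq_of_add_eq (by positivity)
  · apply ne_top_of_le_ne_top (b := ENNReal.ofReal m * μ univ)
    · exact ENNReal.mul_ne_top (by simp) (by simp)
    · rw [← lintegral_const]
      apply lintegral_mono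
      intro x
      have : (m : EReal) - (g x : EReal) ≤ m := by
        simpa using EReal.sub_le_sub (le_refl (m : EReal)) (EReal.coe_ennreal_nonneg (g x))
      simpa using EReal.toENNReal_le_toENNReal this
  · rw [← lintegral_add_left' hg]
    simp_rw [key]
    rw [lintegral_add_right _ measurable_const, lintegral_const, ENNReal.ofReal_mul hm,
      Measure.real, ENNReal.ofReal_toReal (measure_ne_top _ _)]

/-! ### The shifted logarithm -/

/-- The function `x ↦ log (R / x)`, truncated below at `0`. -/
noncomputable def shiftedLog (R : ℝ) (x : ENNReal) : ENNReal :=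
  (ENNReal.log (ENNReal.ofReal R / x)).toENNReal

lemma continuous_shiftedLog {R : ℝ} : Continuous (shiftedLog R) := by
  have : Continuous fun x : ENNReal => ENNReal.ofReal R / x := by
    simp_rw [div_eq_mul_inv]
    exact (ENNReal.continuous_const_mul ENNReal.ofReal_ne_top).comp continuous_inv
  exact EReal.continuous_toENNReal.comp (ENNReal.continuous_log.comp this)

lemma shiftedLog_antitone (R : ℝ) : Antitone (shiftedLog R) := fun _ _ h =>
  EReal.toENNReal_le_toENNReal (ENNReal.log_le_log (ENNReal.div_le_div_left h _))

@[simp] lemma shiftedLog_zero {R : ℝ} (hR : 0 < R) : shiftedLog R 0 = ⊤ := by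
  simp [shiftedLog, ENNReal.div_zero, hR]

lemma shiftedLog_ofReal {R r : ℝ} (hr : 0 < r) (hR : 0 < R) :
    shiftedLog R (ENNReal.ofReal r) = ENNReal.ofReal (Real.log (R / r)) := by
  rw [shiftedLog, ← ENNReal.ofReal_div_of_pos hr, ENNReal.log_ofReal_of_pos (div_pos hR hr),
    EReal.toENNReal_of_ne_top (by simp), EReal.toReal_coe]

lemma shiftedLog_ofReal_ne_top {R r : ℝ} (hr : 0 < r) (hR : 0 < R) :
    shiftedLog R (ENNReal.ofReal r) ≠ ⊤ := by simp [shiftedLog_ofReal hr hR]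

lemma neg_log_eq_shiftedLog_sub {R : ℝ} (hR : 0 < R) {x : ENNReal} (hx : x ≤ ENNReal.ofReal R) :
    -ENNReal.log x = (shiftedLog R x : EReal) - (Real.log R : EReal) := by
  have h0 : 0 ≤ ENNReal.log (ENNReal.ofReal R / x) := by
    rw [ENNReal.zero_le_log_iff]
    rcases eq_or_ne x 0 with rfl | h
    · simp [ENNReal.div_zero, hR]
    · rw [ENNReal.le_div_iff_mul_le (Or.inl h) (Or.inl (ne_top_of_le_ne_top (by simp) hx))]
      simpa using hx
  rw [shiftedLog, EReal.coe_toENNReal h0, div_eq_mul_inv, ENNReal.log_mul_add, ENNReal.log_inv,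
    ENNReal.log_ofReal_of_pos hR, add_comm, EReal.add_sub_cancel_right]

/-! ### The shifted energy -/

/-- The energy of a measure for the kernel `log (R / |p - q|)`. -/
noncomputable def shiftedEnergy (R : ℝ) (μ : Measure Space) : ENNReal :=
  ∫⁻ p, ∫⁻ q, shiftedLog R (edist p q) ∂μ ∂μ

lemma measurable_shiftedLog_edist (R : ℝ) :
    Measurable fun pq : Space × Space => shiftedLog R (edist pq.1 pq.2) :=
  (continuous_shiftedLog.comp continuous_edist).measurable

/-- On a set of diameter at most R the kernel log (R/|p - q|) is nonnegative, so the truncation in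
`shiftedLog` is inactive and the energy changes by a constant. Minimization thereby moves to
`ENNReal`, where Tonelli and Fatou apply freely. -/
lemma logEnergy_eq_shiftedEnergy_sub {R : ℝ} (hR : 1 ≤ R) {B : Set Space}
    (hB : ∀ p ∈ B, ∀ q ∈ B, edist p q ≤ ENNReal.ofReal R) {μ : Measure Space} (hμ : μ ∈ probOn B) :
    logEnergy μ = (shiftedEnergy R μ : EReal) - (Real.log R : EReal) := by
  have := hμ.1
  have hm : ∀ᵐ p ∂μ, p ∈ B := hμ.2
  have h := extIntegral_eq_of_ae_eq_sub (μ := μ.prod μ)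
    (f := fun pq => logKernel pq.1 pq.2) (measurable_shiftedLog_edist R).aemeasurable
    (Real.log_nonneg hR) (by
      have h1 : ∀ᵐ pq ∂(μ.prod μ), pq.1 ∈ B := Measure.quasiMeasurePreserving_fst.ae hm
      have h2 : ∀ᵐ pq ∂(μ.prod μ), pq.2 ∈ B := Measure.quasiMeasurePreserving_snd.ae hm
      filter_upwards [h1, h2] with pq hp hq
      exact neg_log_eq_shiftedLog_sub (by linarith) (hB _ hp _ hq))
  rw [logEnergy, h, lintegral_prod _ (measurable_shiftedLog_edist R).aemeasurable]
  simp [shiftedEnergy]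

lemma isLogEquilibriumMeasure_iff {R : ℝ} (hR : 1 ≤ R) {B : Set Space}
    (hB : ∀ p ∈ B, ∀ q ∈ B, edist p q ≤ ENNReal.ofReal R) {μ : Measure Space} :
    IsLogEquilibriumMeasure B μ ↔
      μ ∈ probOn B ∧ ∀ ν ∈ probOn B, shiftedEnergy R μ ≤ shiftedEnergy R ν := by
  rw [IsLogEquilibriumMeasure, minLogEnergy]
  refine and_congr_right fun hμ => ?_
  have hle : logEnergy μ = (⨅ ν ∈ probOn B, logEnergy ν) ↔
      ∀ ν ∈ probOn B, logEnergy μ ≤ logEnergy ν :=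
    ⟨fun h ν hν => h ▸ iInf₂_le ν hν, fun h => le_antisymm (le_iInf₂ h) (iInf₂_le μ hμ)⟩
  rw [hle]
  refine forall₂_congr fun ν hν => ?_
  rw [logEnergy_eq_shiftedEnergy_sub hR hB hμ, logEnergy_eq_shiftedEnergy_sub hR hB hν]
  constructor
  · intro h
    have h2 := add_le_add_left h (Real.log R : EReal)
    simpa [EReal.sub_add_cancel] using h2
  · intro h
    exact EReal.sub_le_sub (by exact_mod_cast h) le_rfl

end Revolution

namespace Revolution

open ProbabilityTheory Filter Topology

/-! ### Gaussian representation of the logarithmic kernel -/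

lemma integral_mul_exp_neg_mul_sq {s : ℝ} (hs : s ≠ 0) (r R : ℝ) :
    ∫ u in r..R, u * Real.exp (-s * u ^ 2) =
      (Real.exp (-s * r ^ 2) - Real.exp (-s * R ^ 2)) / (2 * s) := by
  have h : ∀ u ∈ uIcc r R, HasDerivAt (fun u : ℝ => -Real.exp (-s * u ^ 2) / (2 * s))
      (u * Real.exp (-s * u ^ 2)) u := by
    intro u _
    have h1 : HasDerivAt (fun u : ℝ => -s * u ^ 2) (-s * (2 * u)) u := by
      simpa using (hasDerivAt_pow 2 u).const_mul (-s)
    refine (h1.exp.neg.div_const (2 * s)).congr_deriv ?_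
    field_simp
  rw [intervalIntegral.integral_eq_sub_of_hasDerivAt h
    (Continuous.intervalIntegrable (by fun_prop) _ _)]
  ring

lemma lintegral_inv_Ioc {r R : ℝ} (hr : 0 ≤ r) (hrR : r ≤ R) (hR : 0 < R) :
    ∫⁻ u in Ioc r R, ENNReal.ofReal u⁻¹ = shiftedLog R (ENNReal.ofReal r) := by
  rcases hr.eq_or_lt with rfl | hr
  · rw [ENNReal.ofReal_zero, shiftedLog_zero hR]
    -- Both sides are infinite because 1/u is not integrable at 0.
    by_contra h
    have h1 : IntegrableOn (fun u : ℝ => u⁻¹) (Ioc 0 R) := by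
      refine ⟨by fun_prop, ?_⟩
      rw [hasFiniteIntegral_iff_ofReal]
      · exact lt_top_iff_ne_top.2 h
      · filter_upwards [ae_restrict_mem measurableSet_Ioc] with u hu
        exact inv_nonneg.2 hu.1.le
    have h2 := (intervalIntegrable_iff_integrableOn_Ioc_of_le hR.le).2 h1
    rw [intervalIntegrable_inv_iff] at h2
    rcases h2 with h2 | h2
    · exact hR.ne h2
    · exact h2 left_mem_uIcc
  · have hi : IntervalIntegrable (fun u : ℝ => u⁻¹) volume r R := by
      rw [intervalIntegrable_inv_iff, uIcc_of_le hrR]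
      exact Or.inr fun h => by linarith [h.1]
    rw [shiftedLog_ofReal hr hR, ← integral_inv_of_pos hr hR,
      intervalIntegral.integral_of_le hrR, ofReal_integral_eq_lintegral_ofReal]
    · exact (intervalIntegrable_iff_integrableOn_Ioc_of_le hrR).1 hi
    · filter_upwards [ae_restrict_mem measurableSet_Ioc] with u hu
      exact inv_nonneg.2 (hr.trans hu.1).le

lemma lintegral_mul_exp_neg_mul_sq {u : ℝ} (hu : 0 < u) :
    ∫⁻ s in Ioi (0 : ℝ), ENNReal.ofReal (u * Real.exp (-s * u ^ 2)) = ENNReal.ofReal u⁻¹ := by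
  have hu2 : 0 < u ^ 2 := by positivity
  have h1 : ∫ s in Ioi (0 : ℝ), u * Real.exp (-s * u ^ 2) = u⁻¹ := by
    have h2 := integral_exp_mul_Ioi (a := -u ^ 2) (by linarith) 0
    have h3 : ∀ s : ℝ, Real.exp (-s * u ^ 2) = Real.exp (-u ^ 2 * s) := fun s => by
      congr 1; ring
    simp_rw [h3]
    rw [integral_const_mul, h2]
    simp
    field_simp
  rw [← h1, ofReal_integral_eq_lintegral_ofReal]
  · have h2 := integrableOn_exp_mul_Ioi (a := -u ^ 2) (by linarith) 0
    refine (h2.const_mul u).congr (ae_of_all _ fun s => ?_)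
    simp only
    congr 2; ring
  · exact ae_of_all _ fun s => by positivity

/-- The logarithmic kernel is a superposition of Gaussian kernels. -/
lemma shiftedLog_eq_lintegral {r R : ℝ} (hr : 0 ≤ r) (hrR : r ≤ R) (hR : 0 < R) :
    shiftedLog R (ENNReal.ofReal r) = ∫⁻ s in Ioi (0 : ℝ),
      ENNReal.ofReal ((Real.exp (-s * r ^ 2) - Real.exp (-s * R ^ 2)) / (2 * s)) := by
  rw [← lintegral_inv_Ioc hr hrR hR]
  -- Write 1/u = ∫_0^∞ u exp (-s u²) ds, then integrate in u first.
  have h1 : ∫⁻ u in Ioc r R, ENNReal.ofReal u⁻¹ =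
      ∫⁻ u in Ioc r R, ∫⁻ s in Ioi (0 : ℝ), ENNReal.ofReal (u * Real.exp (-s * u ^ 2)) := by
    refine setLIntegral_congr_fun measurableSet_Ioc fun u hu => ?_
    exact (lintegral_mul_exp_neg_mul_sq (hr.trans_lt hu.1)).symm
  rw [h1, lintegral_lintegral_swap (by fun_prop)]
  refine setLIntegral_congr_fun measurableSet_Ioi fun s hs => ?_
  have hs : (0 : ℝ) < s := hs
  rw [← integral_mul_exp_neg_mul_sq hs.ne', intervalIntegral.integral_of_le hrR,
    ofReal_integral_eq_lintegral_ofReal]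
  · exact Continuous.integrableOn_Ioc (by fun_prop)
  · filter_upwards [ae_restrict_mem measurableSet_Ioc] with u hu
    have : 0 ≤ u := hr.trans hu.1.le
    positivity

/-! ### Gaussian energies -/

/-- The Gaussian energy of a measure, in terms of its characteristic function. -/
noncomputable def gaussEnergy (s : ℝ) (μ : Measure Space) : ℝ :=
  ∫ ξ, ‖charFun μ (Real.sqrt (2 * s) • ξ)‖ ^ 2 ∂(stdGaussian Space)

lemma continuous_charFun_space (μ : Measure Space) [IsFiniteMeasure μ] : Continuous (charFun μ) := by
  fun_prop

/-- The standard normal law has characteristic function exp (-|v|²/2); at v = √(2s) (p - q) this is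
the Gaussian kernel, and Fubini exchanges the normal variable with (p, q). The energy thus appears
as a squared norm. -/
lemma gaussEnergy_eq_integral {s : ℝ} (hs : 0 ≤ s) (μ : Measure Space) [IsProbabilityMeasure μ] :
    gaussEnergy s μ = ∫ pq, Real.exp (-s * dist pq.1 pq.2 ^ 2) ∂(μ.prod μ) := by
  set c := Real.sqrt (2 * s) with hc
  have hc2 : c ^ 2 = 2 * s := Real.sq_sqrt (by linarith)
  have hF : Integrable (Function.uncurry fun (ξ : Space) (pq : Space × Space) =>
      Complex.exp ((inner ℝ (pq.1 - pq.2) (c • ξ) : ℝ) * Complex.I))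
      ((stdGaussian Space).prod (μ.prod μ)) := by
    refine Integrable.of_bound (C := 1) (Continuous.aestronglyMeasurable ?_)
      (ae_of_all _ fun x => ?_)
    · unfold Function.uncurry
      fun_prop
    · simp [Function.uncurry, Complex.norm_exp_ofReal_mul_I]
  -- The squared modulus is the characteristic function of the difference of two independent points
  -- with law μ.
  have h1 : ∀ ξ : Space, ((‖charFun μ (c • ξ)‖ ^ 2 : ℝ) : ℂ) =
      ∫ pq, Complex.exp ((inner ℝ (pq.1 - pq.2) (c • ξ) : ℝ) * Complex.I) ∂(μ.prod μ) := by
    intro ξ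
    have h2 : ∀ pq : Space × Space,
        Complex.exp ((inner ℝ (pq.1 - pq.2) (c • ξ) : ℝ) * Complex.I) =
        Complex.exp ((inner ℝ pq.1 (c • ξ) : ℝ) * Complex.I) *
          Complex.exp ((inner ℝ pq.2 (-(c • ξ)) : ℝ) * Complex.I) := by
      intro pq
      rw [← Complex.exp_add, inner_sub_left, inner_neg_right]
      congr 1; push_cast; ring
    simp_rw [h2]
    rw [integral_prod_mul (f := fun p : Space => Complex.exp ((inner ℝ p (c • ξ) : ℝ) * Complex.I))
      (g := fun p : Space => Complex.exp ((inner ℝ p (-(c • ξ)) : ℝ) * Complex.I)),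
      ← charFun_apply, ← charFun_apply, charFun_neg, Complex.mul_conj, Complex.normSq_eq_norm_sq]
  have h3 : ((gaussEnergy s μ : ℝ) : ℂ) =
      ∫ pq, ((Real.exp (-s * dist pq.1 pq.2 ^ 2) : ℝ) : ℂ) ∂(μ.prod μ) := by
    rw [gaussEnergy, ← integral_complex_ofReal]
    simp_rw [← hc, h1]
    rw [integral_integral_swap hF]
    refine integral_congr_ae (ae_of_all _ fun pq => ?_)
    have h4 := charFun_stdGaussian (c • (pq.1 - pq.2))
    rw [charFun_apply] at h4
    simp only
    have h5 : ∀ ξ : Space, (inner ℝ (pq.1 - pq.2) (c • ξ) : ℝ) = inner ℝ ξ (c • (pq.1 - pq.2)) := by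
      intro ξ
      rw [real_inner_smul_right, real_inner_smul_right, real_inner_comm]
    simp_rw [h5]
    rw [h4, ← Complex.ofReal_pow, norm_smul, mul_pow, Real.norm_eq_abs, sq_abs, hc2, dist_eq_norm]
    push_cast
    congr 1; ring
  rw [integral_complex_ofReal] at h3
  exact_mod_cast h3

lemma measurable_gaussEnergy (μ : Measure Space) [IsFiniteMeasure μ] :
    Measurable fun s => gaussEnergy s μ := by
  have h : StronglyMeasurable (Function.uncurry fun (s : ℝ) (ξ : Space) =>
      ‖charFun μ (Real.sqrt (2 * s) • ξ)‖ ^ 2) := by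
    apply Continuous.stronglyMeasurable
    have := continuous_charFun_space μ
    unfold Function.uncurry
    fun_prop
  exact (h.integral_prod_right (ν := stdGaussian Space)).measurable

lemma ae_dist_le {R : ℝ} (hR : 0 < R) {B : Set Space}
    (hB : ∀ p ∈ B, ∀ q ∈ B, edist p q ≤ ENNReal.ofReal R) {μ : Measure Space} (hμ : μ ∈ probOn B) :
    ∀ᵐ pq ∂(μ.prod μ), dist pq.1 pq.2 ≤ R := by
  have := hμ.1
  have hm : ∀ᵐ p ∂μ, p ∈ B := hμ.2
  have h1 : ∀ᵐ pq ∂(μ.prod μ), pq.1 ∈ B := Measure.quasiMeasurePreserving_fst.ae hm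
  have h2 : ∀ᵐ pq ∂(μ.prod μ), pq.2 ∈ B := Measure.quasiMeasurePreserving_snd.ae hm
  filter_upwards [h1, h2] with pq hp hq
  have := hB _ hp _ hq
  rwa [edist_dist, ENNReal.ofReal_le_ofReal_iff hR.le] at this

lemma integrable_exp_neg_mul_dist_sq {s : ℝ} (hs : 0 ≤ s) (μ : Measure Space)
    [IsProbabilityMeasure μ] :
    Integrable (fun pq : Space × Space => Real.exp (-s * dist pq.1 pq.2 ^ 2)) (μ.prod μ) := by
  refine Integrable.of_bound (C := 1) (Continuous.aestronglyMeasurable (by fun_prop))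
    (ae_of_all _ fun x => ?_)
  rw [Real.norm_eq_abs, Real.abs_exp, Real.exp_le_one_iff]
  have : 0 ≤ s * dist x.1 x.2 ^ 2 := by positivity
  linarith

/-- The energy as a superposition of Gaussian energies. -/
lemma shiftedEnergy_eq_lintegral {R : ℝ} (hR : 0 < R) {B : Set Space}
    (hB : ∀ p ∈ B, ∀ q ∈ B, edist p q ≤ ENNReal.ofReal R) {μ : Measure Space} (hμ : μ ∈ probOn B) :
    shiftedEnergy R μ = ∫⁻ s in Ioi (0 : ℝ),
      ENNReal.ofReal ((gaussEnergy s μ - Real.exp (-s * R ^ 2)) / (2 * s)) := by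
  have := hμ.1
  have hd := ae_dist_le hR hB hμ
  rw [shiftedEnergy, ← lintegral_prod _ (measurable_shiftedLog_edist R).aemeasurable]
  have h1 : ∫⁻ pq, shiftedLog R (edist pq.1 pq.2) ∂(μ.prod μ) =
      ∫⁻ pq, (∫⁻ s in Ioi (0 : ℝ), ENNReal.ofReal ((Real.exp (-s * dist pq.1 pq.2 ^ 2)
        - Real.exp (-s * R ^ 2)) / (2 * s))) ∂(μ.prod μ) := by
    refine lintegral_congr_ae (hd.mono fun pq h => ?_)
    simp only
    rw [edist_dist, shiftedLog_eq_lintegral dist_nonneg h hR]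
  rw [h1, lintegral_lintegral_swap (by fun_prop)]
  refine setLIntegral_congr_fun measurableSet_Ioi fun s hs => ?_
  have hs : (0 : ℝ) < s := hs
  have hint := integrable_exp_neg_mul_dist_sq hs.le μ
  rw [gaussEnergy_eq_integral hs.le, ← ofReal_integral_eq_lintegral_ofReal]
  · rw [integral_div, integral_sub hint (integrable_const _)]
    simp
  · exact (hint.sub (integrable_const _)).div_const _
  · filter_upwards [hd] with pq h
    refine div_nonneg (sub_nonneg.2 (Real.exp_le_exp.2 ?_)) (by positivity)
    have : dist pq.1 pq.2 ^ 2 ≤ R ^ 2 := by gcongr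
    nlinarith

/-- Needed so that a nonnegative continuous function that is not identically zero has positive
Gaussian integral. -/
instance : (stdGaussian Space).IsOpenPosMeasure := by
  have h1 : (gaussianReal 0 1).IsOpenPosMeasure :=
    (gaussianReal_absolutelyContinuous' 0 one_ne_zero).isOpenPosMeasure
  rw [← map_pi_eq_stdGaussian]
  exact (PiLp.continuous_toLp 2 _).isOpenPosMeasure_map (WithLp.toLp_surjective 2)

end Revolution

namespace Revolution

open ProbabilityTheory Filter Topology

/-! ### Existence and uniqueness of the minimizer -/

lemma norm_charFun_sq_le_one (μ : Measure Space) [IsProbabilityMeasure μ] (ξ : Space) :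
    ‖charFun μ ξ‖ ^ 2 ≤ 1 :=
  pow_le_one₀ (norm_nonneg _) (norm_charFun_le_one ξ)

/-- Weak convergence is pointwise convergence of characteristic functions, which are bounded by 1,
so dominated convergence applies. -/
lemma tendsto_gaussEnergy {μ : ℕ → ProbabilityMeasure Space} {ν : ProbabilityMeasure Space}
    (h : Tendsto μ atTop (𝓝 ν)) (s : ℝ) :
    Tendsto (fun n => gaussEnergy s (μ n)) atTop (𝓝 (gaussEnergy s ν)) := by
  refine tendsto_integral_of_dominated_convergence (fun _ => 1) (fun n => ?_)
    (integrable_const _) (fun n => ae_of_all _ fun ξ => ?_) (ae_of_all _ fun ξ => ?_)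
  · have := continuous_charFun_space (μ n : Measure Space)
    exact Continuous.aestronglyMeasurable (by fun_prop)
  · rw [Real.norm_of_nonneg (by positivity)]
    exact norm_charFun_sq_le_one _ _
  · exact ((ProbabilityMeasure.tendsto_iff_tendsto_charFun.1 h _).norm).pow 2

/-- The direct method: a minimizing sequence has a weak limit point on B, and Fatou in the Gaussian
parameter s makes the energy lower semicontinuous along it. -/
lemma exists_minimizer_shiftedEnergy {R : ℝ} (hR : 0 < R) {B : Set Space} (hBc : IsCompact B)
    (hBne : B.Nonempty) (hB : ∀ p ∈ B, ∀ q ∈ B, edist p q ≤ ENNReal.ofReal R) :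
    ∃ μ ∈ probOn B, ∀ ν ∈ probOn B, shiftedEnergy R μ ≤ shiftedEnergy R ν := by
  obtain ⟨p, hp⟩ := hBne
  have hne : (shiftedEnergy R '' probOn B).Nonempty := by
    -- Its energy is infinite, which is harmless: the minimum is allowed to be `⊤` here.
    refine ⟨_, Measure.dirac p, ⟨inferInstance, ?_⟩, rfl⟩
    rw [Measure.dirac_apply' _ hBc.measurableSet.compl]
    simp [hp]
  obtain ⟨u, -, hu, hmem⟩ := exists_seq_tendsto_sInf hne (OrderBot.bddBelow _)
  choose m hm hmu using hmem
  -- The constant sequences 0 and B turn the tightness condition into "no mass outside B".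
  have hcomp := isCompact_setOfPred_probabilityMeasure_mass_eq_compl_isCompact_le
    (E := Space) (u := fun _ => 0) (K := fun _ => B) tendsto_const_nhds (fun _ => hBc)
    (Or.inl inferInstance)
  obtain ⟨μ, hμ, φ, hφ, hlim⟩ := hcomp.isSeqCompact
    (x := fun n => (⟨m n, (hm n).1⟩ : ProbabilityMeasure Space)) (fun n k => by
      have h : ((⟨m n, (hm n).1⟩ : ProbabilityMeasure Space) : Measure Space) Bᶜ = 0 := (hm n).2
      exact le_of_eq ((ProbabilityMeasure.null_iff_toMeasure_null _ _).2 h))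
  have hμB : (μ : Measure Space) ∈ probOn B := by
    refine ⟨inferInstance, ?_⟩
    have := hμ 0
    rw [← ProbabilityMeasure.null_iff_toMeasure_null]
    exact le_antisymm this bot_le
  refine ⟨μ, hμB, fun ν hν => ?_⟩
  have hle : shiftedEnergy R μ ≤ sInf (shiftedEnergy R '' probOn B) := by
    have h1 : ∀ n, shiftedEnergy R (m (φ n)) = ∫⁻ s in Ioi (0 : ℝ),
        ENNReal.ofReal ((gaussEnergy s (m (φ n)) - Real.exp (-s * R ^ 2)) / (2 * s)) :=
      fun n => shiftedEnergy_eq_lintegral hR hB (hm _)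
    have h2 : Tendsto (fun n => shiftedEnergy R (m (φ n))) atTop
        (𝓝 (sInf (shiftedEnergy R '' probOn B))) := by
      have := hu.comp hφ.tendsto_atTop
      refine this.congr fun n => ?_
      simp [hmu]
    rw [← h2.liminf_eq, shiftedEnergy_eq_lintegral hR hB hμB]
    simp_rw [h1]
    have h3 := lintegral_liminf_le (u := atTop) (μ := volume.restrict (Ioi (0 : ℝ)))
      (f := fun (n : ℕ) s => ENNReal.ofReal
        ((gaussEnergy s (m (φ n)) - Real.exp (-s * R ^ 2)) / (2 * s))) (fun n => by
          have := (hm (φ n)).1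
          have := measurable_gaussEnergy (m (φ n))
          fun_prop)
    refine le_trans (le_of_eq ?_) h3
    refine lintegral_congr fun s => ?_
    have h4 := tendsto_gaussEnergy hlim s
    exact (ENNReal.tendsto_ofReal ((h4.sub_const _).div_const _)).liminf_eq.symm
  exact hle.trans (sInf_le ⟨ν, hν, rfl⟩)

/-- The midpoint of two measures. -/
noncomputable def midpointMeasure (μ ν : Measure Space) : Measure Space :=
  (2⁻¹ : ENNReal) • (μ + ν)

lemma midpointMeasure_mem_probOn {B : Set Space} {μ ν : Measure Space} (hμ : μ ∈ probOn B)
    (hν : ν ∈ probOn B) : midpointMeasure μ ν ∈ probOn B := by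
  have := hμ.1
  have := hν.1
  refine ⟨⟨?_⟩, ?_⟩
  · simp only [midpointMeasure, Measure.smul_apply, Measure.add_apply, measure_univ, smul_eq_mul]
    rw [one_add_one_eq_two]
    exact ENNReal.inv_mul_cancel (by simp) (by simp)
  · simp [midpointMeasure, hμ.2, hν.2]

lemma charFun_midpointMeasure (μ ν : Measure Space) [IsProbabilityMeasure μ]
    [IsProbabilityMeasure ν] (ξ : Space) :
    charFun (midpointMeasure μ ν) ξ = (2⁻¹ : ℂ) * (charFun μ ξ + charFun ν ξ) := by
  have hi : ∀ ρ : Measure Space, IsProbabilityMeasure ρ →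
      Integrable (fun x => Complex.exp ((inner ℝ x ξ : ℝ) * Complex.I)) ρ := by
    intro ρ hρ
    refine Integrable.of_bound (C := 1) (Continuous.aestronglyMeasurable (by fun_prop))
      (ae_of_all _ fun x => ?_)
    simp [Complex.norm_exp_ofReal_mul_I]
  simp only [charFun_apply, midpointMeasure]
  rw [integral_smul_measure, integral_add_measure (hi μ inferInstance) (hi ν inferInstance)]
  simp [mul_add]

lemma integrable_norm_charFun_sq (μ : Measure Space) [IsProbabilityMeasure μ] (s : ℝ) :
    Integrable (fun ξ => ‖charFun μ (Real.sqrt (2 * s) • ξ)‖ ^ 2) (stdGaussian Space) := by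
  have := continuous_charFun_space μ
  refine Integrable.of_bound (C := 1) (Continuous.aestronglyMeasurable (by fun_prop))
      (ae_of_all _ fun ξ => ?_)
  rw [Real.norm_of_nonneg (by positivity)]
  exact norm_charFun_sq_le_one _ _

/-- The squared distance of two measures for the Gaussian kernel. -/
noncomputable def gaussDistSq (s : ℝ) (μ ν : Measure Space) : ℝ :=
  ∫ ξ, ‖charFun μ (Real.sqrt (2 * s) • ξ) - charFun ν (Real.sqrt (2 * s) • ξ)‖ ^ 2
    ∂(stdGaussian Space)

lemma integrable_norm_charFun_sub_sq (μ ν : Measure Space) [IsProbabilityMeasure μ]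
    [IsProbabilityMeasure ν] (s : ℝ) :
    Integrable (fun ξ => ‖charFun μ (Real.sqrt (2 * s) • ξ) -
      charFun ν (Real.sqrt (2 * s) • ξ)‖ ^ 2) (stdGaussian Space) := by
  have := continuous_charFun_space μ
  have := continuous_charFun_space ν
  refine Integrable.of_bound (C := 4) (Continuous.aestronglyMeasurable (by fun_prop))
      (ae_of_all _ fun ξ => ?_)
  rw [Real.norm_of_nonneg (by positivity)]
  have h1 := norm_sub_le (charFun μ (Real.sqrt (2 * s) • ξ)) (charFun ν (Real.sqrt (2 * s) • ξ))
  have h2 := norm_charFun_le_one (μ := μ) (Real.sqrt (2 * s) • ξ)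
  have h3 := norm_charFun_le_one (μ := ν) (Real.sqrt (2 * s) • ξ)
  have h4 := norm_nonneg (charFun μ (Real.sqrt (2 * s) • ξ) - charFun ν (Real.sqrt (2 * s) • ξ))
  nlinarith

/-- The parallelogram law for the two characteristic functions, integrated; the defect `gaussDistSq`
measures strict convexity. -/
lemma gaussEnergy_midpointMeasure (μ ν : Measure Space) [IsProbabilityMeasure μ]
    [IsProbabilityMeasure ν] (s : ℝ) :
    2 * gaussEnergy s (midpointMeasure μ ν) + gaussDistSq s μ ν / 2 =
      gaussEnergy s μ + gaussEnergy s ν := by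
  have h : ∀ ξ : Space, ‖charFun (midpointMeasure μ ν) (Real.sqrt (2 * s) • ξ)‖ ^ 2 =
      (2⁻¹ * ‖charFun μ (Real.sqrt (2 * s) • ξ)‖ ^ 2 +
        2⁻¹ * ‖charFun ν (Real.sqrt (2 * s) • ξ)‖ ^ 2) -
        4⁻¹ * ‖charFun μ (Real.sqrt (2 * s) • ξ) - charFun ν (Real.sqrt (2 * s) • ξ)‖ ^ 2 := by
    intro ξ
    rw [charFun_midpointMeasure, norm_mul, mul_pow]
    have := parallelogram_law_with_norm ℝ (charFun μ (Real.sqrt (2 * s) • ξ))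
      (charFun ν (Real.sqrt (2 * s) • ξ))
    rw [norm_inv, Complex.norm_ofNat]
    linarith
  have h1 := integrable_norm_charFun_sq μ s
  have h2 := integrable_norm_charFun_sq ν s
  have h3 := integrable_norm_charFun_sub_sq μ ν s
  have gen : ∀ f g k : Space → ℝ, Integrable f (stdGaussian Space) →
      Integrable g (stdGaussian Space) → Integrable k (stdGaussian Space) →
      ∫ ξ, ((2⁻¹ * f ξ + 2⁻¹ * g ξ) - 4⁻¹ * k ξ) ∂(stdGaussian Space) =
        2⁻¹ * ∫ ξ, f ξ ∂(stdGaussian Space) + 2⁻¹ * ∫ ξ, g ξ ∂(stdGaussian Space) -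
          4⁻¹ * ∫ ξ, k ξ ∂(stdGaussian Space) := by
    intro f g k hf hg hk
    rw [integral_sub (f := fun ξ => 2⁻¹ * f ξ + 2⁻¹ * g ξ) (g := fun ξ => 4⁻¹ * k ξ)
      ((hf.const_mul _).add (hg.const_mul _)) (hk.const_mul _),
      integral_add (hf.const_mul _) (hg.const_mul _), integral_const_mul, integral_const_mul,
      integral_const_mul]
  have h4 := gen _ _ _ h1 h2 h3
  simp_rw [← h] at h4
  simp only [gaussEnergy, gaussDistSq]
  linarith

/-- Distinct measures have distinct characteristic functions; by continuity these differ on a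
nonempty open set, which the Gaussian charges. -/
lemma gaussDistSq_pos {μ ν : Measure Space} [IsProbabilityMeasure μ]
    [IsProbabilityMeasure ν] (h : μ ≠ ν) {s : ℝ} (hs : 0 < s) : 0 < gaussDistSq s μ ν := by
  have hμ := continuous_charFun_space μ
  have hν := continuous_charFun_space ν
  obtain ⟨ξ, hξ⟩ : ∃ ξ, charFun μ ξ ≠ charFun ν ξ := by
    by_contra! h'
    exact h (Measure.ext_of_charFun (funext h'))
  have hc : 0 < Real.sqrt (2 * s) := Real.sqrt_pos.2 (by linarith)
  have hcont : Continuous fun ξ : Space => ‖charFun μ (Real.sqrt (2 * s) • ξ) -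
      charFun ν (Real.sqrt (2 * s) • ξ)‖ ^ 2 := by fun_prop
  rw [gaussDistSq, integral_pos_iff_support_of_nonneg (fun ξ => by positivity)
    (integrable_norm_charFun_sub_sq μ ν s)]
  refine hcont.isOpen_support.measure_pos _ ⟨(Real.sqrt (2 * s))⁻¹ • ξ, ?_⟩
  rw [Function.mem_support, smul_smul, mul_inv_cancel₀ hc.ne', one_smul]
  exact pow_ne_zero _ (norm_ne_zero_iff.2 (sub_ne_zero.2 hξ))

/-- Ensures that `ENNReal.ofReal` truncates nothing in the superposition formula for the energy. -/
lemma exp_le_gaussEnergy {R : ℝ} (hR : 0 < R) {B : Set Space}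
    (hB : ∀ p ∈ B, ∀ q ∈ B, edist p q ≤ ENNReal.ofReal R) {μ : Measure Space} (hμ : μ ∈ probOn B)
    {s : ℝ} (hs : 0 ≤ s) : Real.exp (-s * R ^ 2) ≤ gaussEnergy s μ := by
  have := hμ.1
  rw [gaussEnergy_eq_integral hs]
  have h1 : ∫ _pq : Space × Space, Real.exp (-s * R ^ 2) ∂(μ.prod μ) = Real.exp (-s * R ^ 2) := by
    simp
  rw [← h1]
  refine integral_mono_ae (integrable_const _) (integrable_exp_neg_mul_dist_sq hs μ) ?_
  filter_upwards [ae_dist_le hR hB hμ] with pq h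
  refine Real.exp_le_exp.2 ?_
  have : dist pq.1 pq.2 ^ 2 ≤ R ^ 2 := by gcongr
  nlinarith

lemma minimizer_shiftedEnergy_unique {R : ℝ} (hR : 0 < R) {B : Set Space}
    (hB : ∀ p ∈ B, ∀ q ∈ B, edist p q ≤ ENNReal.ofReal R) {μ ν : Measure Space}
    (hμ : μ ∈ probOn B) (hν : ν ∈ probOn B)
    (hμmin : ∀ ρ ∈ probOn B, shiftedEnergy R μ ≤ shiftedEnergy R ρ)
    (hνmin : ∀ ρ ∈ probOn B, shiftedEnergy R ν ≤ shiftedEnergy R ρ)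
    (hfin : shiftedEnergy R μ ≠ ⊤) : μ = ν := by
  have := hμ.1
  have := hν.1
  by_contra hne
  have hm := midpointMeasure_mem_probOn hμ hν
  have := hm.1
  have hEν : shiftedEnergy R ν = shiftedEnergy R μ := le_antisymm (hνmin μ hμ) (hμmin ν hν)
  have hdist : Measurable fun s => gaussDistSq s μ ν := by
    have h : StronglyMeasurable (Function.uncurry fun (s : ℝ) (ξ : Space) =>
        ‖charFun μ (Real.sqrt (2 * s) • ξ) - charFun ν (Real.sqrt (2 * s) • ξ)‖ ^ 2) := by
      apply Continuous.stronglyMeasurable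
      have := continuous_charFun_space μ
      have := continuous_charFun_space ν
      unfold Function.uncurry
      fun_prop
    exact (h.integral_prod_right (ν := stdGaussian Space)).measurable
  -- The midpoint identity divided by 2s and integrated over s. Minimality of μ then forces the
  -- defect integral to vanish, although its integrand is positive; finiteness of the energy permits
  -- the cancellation.
  have h1 : 2 * shiftedEnergy R (midpointMeasure μ ν) +
      ∫⁻ s in Ioi (0 : ℝ), ENNReal.ofReal (gaussDistSq s μ ν / (4 * s)) ≤
      2 * shiftedEnergy R μ := by
    have e1 : 2 * shiftedEnergy R μ = shiftedEnergy R μ + shiftedEnergy R ν := by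
      rw [hEν, two_mul]
    have m1 := measurable_gaussEnergy μ
    have m2 := measurable_gaussEnergy ν
    have m3 := measurable_gaussEnergy (midpointMeasure μ ν)
    rw [e1, shiftedEnergy_eq_lintegral hR hB hμ, shiftedEnergy_eq_lintegral hR hB hν,
      shiftedEnergy_eq_lintegral hR hB hm, ← lintegral_const_mul _ (by fun_prop),
      ← lintegral_add_right _ (by fun_prop), ← lintegral_add_right _ (by fun_prop)]
    refine le_of_eq (setLIntegral_congr_fun measurableSet_Ioi fun s hs => ?_)
    have hs : (0 : ℝ) < s := hs
    have g1 := exp_le_gaussEnergy hR hB hμ hs.le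
    have g2 := exp_le_gaussEnergy hR hB hν hs.le
    have g3 := exp_le_gaussEnergy hR hB hm hs.le
    have g4 := gaussEnergy_midpointMeasure μ ν s
    have g5 := (gaussDistSq_pos hne hs).le
    have p1 : 0 ≤ (gaussEnergy s μ - Real.exp (-s * R ^ 2)) / (2 * s) :=
      div_nonneg (sub_nonneg.2 g1) (by positivity)
    have p2 : 0 ≤ (gaussEnergy s ν - Real.exp (-s * R ^ 2)) / (2 * s) :=
      div_nonneg (sub_nonneg.2 g2) (by positivity)
    have p3 : 0 ≤ (gaussEnergy s (midpointMeasure μ ν) - Real.exp (-s * R ^ 2)) / (2 * s) :=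
      div_nonneg (sub_nonneg.2 g3) (by positivity)
    have e2 : (2 : ENNReal) = ENNReal.ofReal 2 := by simp
    rw [e2, ← ENNReal.ofReal_mul (by norm_num), ← ENNReal.ofReal_add (by positivity)
      (by positivity), ← ENNReal.ofReal_add p1 p2]
    congr 1
    field_simp
    linarith
  have h2 : (∫⁻ s in Ioi (0 : ℝ), ENNReal.ofReal (gaussDistSq s μ ν / (4 * s))) = 0 := by
    have h3 : 2 * shiftedEnergy R μ ≤ 2 * shiftedEnergy R (midpointMeasure μ ν) := by
      gcongr; exact hμmin _ hm
    have h4 : 2 * shiftedEnergy R μ ≠ ⊤ := ENNReal.mul_ne_top (by simp) hfin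
    have h5 := (add_le_add_left h3 _).trans h1
    by_contra h6
    exact absurd h5 (not_le.2 (ENNReal.lt_add_right h4 h6))
  rw [lintegral_eq_zero_iff (by fun_prop)] at h2
  have h7 : ∀ᵐ s ∂(volume.restrict (Ioi (0 : ℝ))), False := by
    filter_upwards [h2, ae_restrict_mem measurableSet_Ioi] with s hs hs0
    have hs0 : (0 : ℝ) < s := hs0
    have := gaussDistSq_pos hne hs0
    have h8 : 0 < gaussDistSq s μ ν / (4 * s) := by positivity
    simp only [Pi.zero_apply, ENNReal.ofReal_eq_zero] at hs
    linarith
  rw [ae_iff] at h7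
  simp at h7

end Revolution

namespace Revolution

open Filter Topology ComplexConjugate

/-! ### Rotations -/

lemma continuous_rot_uncurry : Continuous fun tp : ℝ × Space => rot tp.1 tp.2 := by
  refine (PiLp.continuous_toLp 2 _).comp (continuous_pi fun i => ?_)
  fin_cases i <;> simp <;> fun_prop

lemma continuous_toSpace : Continuous toSpace := by
  refine (PiLp.continuous_toLp 2 _).comp (continuous_pi fun i => ?_)
  fin_cases i <;> simp <;> fun_prop

lemma continuous_rot (t : ℝ) : Continuous (rot t) :=
  continuous_rot_uncurry.comp (by fun_prop : Continuous fun p : Space => (t, p))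

lemma rot_rot (s t : ℝ) (p : Space) : rot s (rot t p) = rot (s + t) p := by
  ext i
  fin_cases i <;> simp [rot, Real.cos_add, Real.sin_add] <;> ring

lemma rot_zero (p : Space) : rot 0 p = p := by
  ext i
  fin_cases i <;> simp [rot]

lemma edist_rot (t : ℝ) (p q : Space) : edist (rot t p) (rot t q) = edist p q := by
  rw [edist_dist, edist_dist, EuclideanSpace.dist_eq, EuclideanSpace.dist_eq]
  congr 2
  simp only [Fin.sum_univ_three, Real.dist_eq, sq_abs, rot]
  simp
  have := Real.sin_sq_add_cos_sq t
  linear_combination ((p 0 - q 0) ^ 2 + (p 2 - q 2) ^ 2) * this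

lemma norm_rot (t : ℝ) (p : Space) : ‖rot t p‖ = ‖p‖ := by
  rw [EuclideanSpace.norm_eq, EuclideanSpace.norm_eq]
  congr 1
  simp only [Fin.sum_univ_three, Real.norm_eq_abs, sq_abs, rot]
  simp
  have := Real.sin_sq_add_cos_sq t
  linear_combination (p 0 ^ 2 + p 2 ^ 2) * this

lemma norm_toSpace (z : ℂ) : ‖toSpace z‖ = ‖z‖ := by
  rw [EuclideanSpace.norm_eq, Complex.norm_def, Complex.normSq_apply]
  congr 1
  simp [Fin.sum_univ_three, toSpace]
  ring

lemma profile_rot (t : ℝ) (p : Space) : profile (rot t p) = profile p := by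
  have := Real.sin_sq_add_cos_sq t
  have h : (p 0 * Real.cos t - p 2 * Real.sin t) ^ 2 + (p 0 * Real.sin t + p 2 * Real.cos t) ^ 2 =
      p 0 ^ 2 + p 2 ^ 2 := by
    linear_combination (p 0 ^ 2 + p 2 ^ 2) * this
  simp [profile, rot, h]

lemma norm_profile (p : Space) : ‖profile p‖ = ‖p‖ := by
  obtain ⟨t, -, h⟩ := exists_rot_profile p
  conv_rhs => rw [h, norm_rot, norm_toSpace]

lemma continuous_profile : Continuous profile := by
  have : profile = fun p : Space =>
      ((Real.sqrt (p 0 ^ 2 + p 2 ^ 2) : ℝ) : ℂ) + ((p 1 : ℝ) : ℂ) * Complex.I := by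
    funext p
    apply Complex.ext <;> simp [profile]
  rw [this]
  fun_prop

lemma isCompact_revolve {A : Set ℂ} (hA : IsCompact A) (hAH : A ⊆ rightHalfPlane) :
    IsCompact (revolve A) := by
  rw [← profile_preimage hAH]
  refine Metric.isCompact_of_isClosed_isBounded (hA.isClosed.preimage continuous_profile) ?_
  obtain ⟨C, hC⟩ := hA.isBounded.exists_norm_le
  exact isBounded_iff_forall_norm_le.2 ⟨C, fun p hp => norm_profile p ▸ hC _ hp⟩

/-! ### The averaged kernel -/

/-- Half the sum of the distances of `z` to `w` and to its mirror image in the axis. -/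
noncomputable def meanDist (z w : ℂ) : ℝ := (‖z - w‖ + ‖z + conj w‖) / 2

lemma continuous_meanDist : Continuous fun zw : ℂ × ℂ => meanDist zw.1 zw.2 := by
  unfold meanDist
  fun_prop

lemma meanDist_nonneg (z w : ℂ) : 0 ≤ meanDist z w := by unfold meanDist; positivity

lemma meanDist_comm (z w : ℂ) : meanDist z w = meanDist w z := by
  have : ‖w + conj z‖ = ‖z + conj w‖ := by
    rw [← Complex.norm_conj (w + conj z)]
    simp [add_comm]
  rw [meanDist, meanDist, this, norm_sub_rev]

/-- Off the axis this bounds the averaged kernel uniformly in w, diagonal included. -/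
lemma re_div_two_le_meanDist {z w : ℂ} (hw : w ∈ rightHalfPlane) : z.re / 2 ≤ meanDist z w := by
  have h0 : 0 ≤ w.re := hw
  have h1 := Complex.re_le_norm (z + conj w)
  have h2 := norm_nonneg (z - w)
  simp at h1
  unfold meanDist
  linarith

/-- The distance between two circles of revolution as a distance between planar circles. -/
lemma dist_rot_eq {z w : ℂ} (t s : ℝ) :
    dist (rot t (toSpace z)) (rot s (toSpace w)) = ‖circleMap 0 (meanDist z w) t -
      circleMap 0 ((‖z + conj w‖ - ‖z - w‖) / 2) s‖ := by
  have h1 : ‖z - w‖ ^ 2 = (z.re - w.re) ^ 2 + (z.im - w.im) ^ 2 := by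
    rw [← Complex.normSq_eq_norm_sq, Complex.normSq_apply]; simp; ring
  -- With P = |z - w| and Q = |z + conj w|, the planar radii (Q + P)/2 and (Q - P)/2 have product Re
  -- z · Re w and squares summing to (Re z)² + (Re w)² + (Im z - Im w)². Both distances then agree
  -- by the law of cosines.
  have h2 : ‖z + conj w‖ ^ 2 = (z.re + w.re) ^ 2 + (z.im - w.im) ^ 2 := by
    rw [← Complex.normSq_eq_norm_sq, Complex.normSq_apply]; simp; ring
  have h3 := Real.sin_sq_add_cos_sq t
  have h4 := Real.sin_sq_add_cos_sq s
  rw [EuclideanSpace.dist_eq, Complex.norm_def, Complex.normSq_apply]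
  congr 1
  simp only [Fin.sum_univ_three, Real.dist_eq, sq_abs, rot, toSpace, circleMap, meanDist]
  simp [Complex.exp_re, Complex.exp_im]
  set P := ‖z - w‖
  set Q := ‖z + conj w‖
  linear_combination (z.re ^ 2 - ((P + Q) / 2) ^ 2) * h3 + (w.re ^ 2 - ((Q - P) / 2) ^ 2) * h4
    + (-1/2 + (-1/2) * (Real.cos t * Real.cos s + Real.sin t * Real.sin s)) * h1 +
    (-1/2 + 1/2 * (Real.cos t * Real.cos s + Real.sin t * Real.sin s)) * h2

lemma dist_rot_le {z w : ℂ} {R : ℝ} (hz : ‖z‖ ≤ R / 2) (hw : ‖w‖ ≤ R / 2) (t s : ℝ) :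
    dist (rot t (toSpace z)) (rot s (toSpace w)) ≤ R := by
  rw [dist_eq_norm]
  have := norm_sub_le (rot t (toSpace z)) (rot s (toSpace w))
  rw [norm_rot, norm_rot, norm_toSpace, norm_toSpace] at this
  linarith

/-- The kernel `log (R / meanDist z w)`, the average of `log (R / |σ_t z - w|)`. -/
noncomputable def ringKernel (R : ℝ) (z w : ℂ) : ENNReal :=
  shiftedLog R (ENNReal.ofReal (meanDist z w))

/-- The mean of log |· - a| over the circle of radius α about 0 is log α whenever |a| ≤ α, and here
α is `meanDist z w`. -/
lemma lintegral_shiftedLog_rot {R : ℝ} (hR : 0 < R) {z w : ℂ} (hz : ‖z‖ ≤ R / 2) (hw : ‖w‖ ≤ R / 2) (s : ℝ) :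
    ∫⁻ t in Ico 0 (2 * Real.pi),
      shiftedLog R (edist (rot t (toSpace z)) (rot s (toSpace w))) =
      ENNReal.ofReal (2 * Real.pi) * ringKernel R z w := by
  have hpi : 0 < 2 * Real.pi := by positivity
  set a : ℂ := circleMap 0 ((‖z + conj w‖ - ‖z - w‖) / 2) s with ha
  set α := meanDist z w with hα
  have hna : ‖a‖ ≤ α := by
    rw [ha, norm_circleMap_zero, hα, meanDist, abs_le]
    have := norm_nonneg (z - w)
    have := norm_nonneg (z + conj w)
    constructor <;> linarith
  have hα0 : 0 ≤ α := meanDist_nonneg z w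
  have hdle : ∀ t, ‖circleMap 0 α t - a‖ ≤ R := fun t => by
    rw [ha, hα, ← dist_rot_eq]; exact dist_rot_le hz hw t s
  have h1 : ∀ t, shiftedLog R (edist (rot t (toSpace z)) (rot s (toSpace w))) =
      shiftedLog R (ENNReal.ofReal ‖circleMap 0 α t - a‖) := fun t => by
    rw [edist_dist, dist_rot_eq]
  simp_rw [h1]
  rw [ringKernel, ← hα]
  rcases hα0.eq_or_lt with h0 | h0
  -- Radius zero: both orbits are the same point of the axis, and both sides are `⊤`.
  · rw [← h0] at hna ⊢
    have : a = 0 := norm_le_zero_iff.1 hna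
    simp [this, shiftedLog_zero hR, mul_comm]
  -- If |a| = α the logarithm is singular at one point of the circle, hence only on a null set of
  -- angles.
  · have hne : ∀ᵐ t ∂(volume.restrict (Ico 0 (2 * Real.pi))), ‖circleMap 0 α t - a‖ ≠ 0 := by
      refine ae_restrict_of_ae ?_
      have hc := ((countable_singleton a).preimage_circleMap 0 h0.ne').ae_notMem volume
      filter_upwards [hc] with t ht h
      exact ht (sub_eq_zero.1 (norm_eq_zero.1 h))
    have hcirc : CircleIntegrable (fun x => Real.log ‖x - a‖) 0 α :=
      circleIntegrable_log_norm_sub_const α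
    have hint : IntegrableOn (fun t => Real.log ‖circleMap 0 α t - a‖) (Ico 0 (2 * Real.pi)) := by
      rw [integrableOn_Ico_iff_integrableOn_Ioo, ← integrableOn_Ioc_iff_integrableOn_Ioo]
      exact (intervalIntegrable_iff_integrableOn_Ioc_of_le hpi.le).1 hcirc
    have hval : ∫ t in Ico 0 (2 * Real.pi), Real.log ‖circleMap 0 α t - a‖ =
        2 * Real.pi * Real.log α := by
      have h2 := circleAverage_log_norm_sub_const_of_mem_closedBall (c := 0) (a := a) (R := α)
        (by simpa [abs_of_pos h0] using hna)
      rw [Real.circleAverage, intervalIntegral.integral_of_le hpi.le, smul_eq_mul,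
        inv_mul_eq_iff_eq_mul₀ hpi.ne'] at h2
      rw [integral_Ico_eq_integral_Ioo, ← integral_Ioc_eq_integral_Ioo]
      exact h2
    have h3 : ∫⁻ t in Ico 0 (2 * Real.pi), shiftedLog R (ENNReal.ofReal ‖circleMap 0 α t - a‖) =
        ∫⁻ t in Ico 0 (2 * Real.pi),
          ENNReal.ofReal (Real.log R - Real.log ‖circleMap 0 α t - a‖) := by
      refine lintegral_congr_ae (hne.mono fun t ht => ?_)
      have hp : 0 < ‖circleMap 0 α t - a‖ := lt_of_le_of_ne (norm_nonneg _) (Ne.symm ht)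
      simp only
      rw [shiftedLog_ofReal hp hR, Real.log_div hR.ne' ht]
    have hsub : IntegrableOn (fun t => Real.log R - Real.log ‖circleMap 0 α t - a‖)
        (Ico 0 (2 * Real.pi)) := (integrable_const _).sub hint
    rw [h3, ← ofReal_integral_eq_lintegral_ofReal hsub
      (hne.mono fun t ht => sub_nonneg.2 (Real.log_le_log
        (lt_of_le_of_ne (norm_nonneg _) (Ne.symm ht)) (hdle t))),
      integral_sub (integrable_const _) hint, hval, shiftedLog_ofReal h0 hR,
      ← ENNReal.ofReal_mul hpi.le, Real.log_div hR.ne' h0.ne']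
    congr 1
    simp [hpi.le]
    ring

lemma K_eq_ringKernel_sub {R : ℝ} (hR : 1 ≤ R) {z w : ℂ} (hz : ‖z‖ ≤ R / 2) (hw : ‖w‖ ≤ R / 2) :
    K z w = (ringKernel R z w : EReal) - (Real.log R : EReal) := by
  have hR0 : 0 < R := by linarith
  have hpi : 0 < 2 * Real.pi := by positivity
  have h1 := lintegral_shiftedLog_rot hR0 hz hw 0
  simp_rw [rot_zero] at h1
  have hcont : Continuous fun t => shiftedLog R (edist (rot t (toSpace z)) (toSpace w)) := by
    have : Continuous fun t => rot t (toSpace z) :=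
      continuous_rot_uncurry.comp (by fun_prop : Continuous fun t : ℝ => (t, toSpace z))
    exact continuous_shiftedLog.comp (by fun_prop)
  have h2 := extIntegral_eq_of_ae_eq_sub
    (μ := volume.restrict (Ico (0 : ℝ) (2 * Real.pi)))
    (f := fun t => logKernel (rot t (toSpace z)) (toSpace w)) hcont.aemeasurable
    (Real.log_nonneg hR) (ae_of_all _ fun t => neg_log_eq_shiftedLog_sub hR0 (by
      rw [edist_dist]
      have := dist_rot_le hz hw t 0
      rw [rot_zero] at this
      exact ENNReal.ofReal_le_ofReal this))
  rw [K, h2, h1]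
  have hv : (volume.restrict (Ico (0 : ℝ) (2 * Real.pi))).real univ = 2 * Real.pi := by
    simp [Measure.real, Real.pi_pos.le]
  rw [hv]
  generalize ringKernel R z w = κ
  induction κ with
  | top =>
    rw [ENNReal.mul_top (by simpa using Real.pi_pos)]
    simp only [EReal.coe_ennreal_top, EReal.top_sub_coe]
    exact EReal.coe_mul_top_of_pos (by positivity)
  | coe k =>
    rw [EReal.coe_ennreal_mul, EReal.coe_ennreal_ofReal, max_eq_left hpi.le,
      EReal.coe_nnreal_eq_coe_real, ← EReal.coe_mul, ← EReal.coe_sub, ← EReal.coe_mul,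
      ← EReal.coe_sub]
    congr 1
    field_simp

end Revolution

namespace Revolution

open Filter Topology ComplexConjugate

/-! ### Reduction to the half-plane -/

lemma continuous_ringKernel (R : ℝ) : Continuous fun zw : ℂ × ℂ => ringKernel R zw.1 zw.2 :=
  continuous_shiftedLog.comp (ENNReal.continuous_ofReal.comp continuous_meanDist)

lemma measurable_ringKernel (R : ℝ) : Measurable (Function.uncurry (ringKernel R)) :=
  (continuous_ringKernel R).measurable

lemma measurable_ringKernel_right (R : ℝ) (z : ℂ) : Measurable (ringKernel R z) :=
  (measurable_ringKernel R).of_uncurry_left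

lemma ringKernel_comm (R : ℝ) (z w : ℂ) : ringKernel R z w = ringKernel R w z := by
  rw [ringKernel, ringKernel, meanDist_comm]

/-- The potential of a measure for the averaged kernel. -/
noncomputable def ringPotential (R : ℝ) (ν : Measure ℂ) (z : ℂ) : ENNReal :=
  ∫⁻ w, ringKernel R z w ∂ν

/-- The energy of a measure for the averaged kernel. -/
noncomputable def ringEnergy (R : ℝ) (ν : Measure ℂ) : ENNReal :=
  ∫⁻ z, ringPotential R ν z ∂ν

lemma measurable_ringPotential (R : ℝ) (ν : Measure ℂ) [SFinite ν] :
    Measurable (ringPotential R ν) :=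
  (measurable_ringKernel R).lintegral_prod_right'

/-- The uniform distribution on the angles. -/
noncomputable def angleMeasure : Measure ℝ :=
  (ENNReal.ofReal (2 * Real.pi))⁻¹ • volume.restrict (Ico 0 (2 * Real.pi))

lemma ofReal_two_pi_ne_zero : ENNReal.ofReal (2 * Real.pi) ≠ 0 := by
  simpa using Real.pi_pos

instance : IsProbabilityMeasure angleMeasure := by
  refine ⟨?_⟩
  rw [angleMeasure, Measure.smul_apply, Measure.restrict_apply_univ, Real.volume_Ico, sub_zero,
    smul_eq_mul, ENNReal.inv_mul_cancel ofReal_two_pi_ne_zero ENNReal.ofReal_ne_top]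

lemma lintegral_angleMeasure_shiftedLog_rot {R : ℝ} (hR : 0 < R) {z w : ℂ}
    (hz : ‖z‖ ≤ R / 2) (hw : ‖w‖ ≤ R / 2) (s : ℝ) :
    ∫⁻ t, shiftedLog R (edist (rot t (toSpace z)) (rot s (toSpace w))) ∂angleMeasure =
      ringKernel R z w := by
  rw [angleMeasure, lintegral_smul_measure, lintegral_shiftedLog_rot hR hz hw, smul_eq_mul,
    ← mul_assoc, ENNReal.inv_mul_cancel ofReal_two_pi_ne_zero ENNReal.ofReal_ne_top, one_mul]

/-- The rotation invariant measure in space with a given profile. -/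
noncomputable def revolveMeasure (ν : Measure ℂ) : Measure Space :=
  (ν.prod angleMeasure).map fun zt => rot zt.2 (toSpace zt.1)

lemma continuous_rot_toSpace : Continuous fun zt : ℂ × ℝ => rot zt.2 (toSpace zt.1) :=
  continuous_rot_uncurry.comp
    (by have := continuous_toSpace; fun_prop : Continuous fun zt : ℂ × ℝ => (zt.2, toSpace zt.1))

lemma lintegral_revolveMeasure {ν : Measure ℂ} {f : Space → ENNReal} (hf : Measurable f) :
    ∫⁻ p, f p ∂(revolveMeasure ν) = ∫⁻ zt, f (rot zt.2 (toSpace zt.1)) ∂(ν.prod angleMeasure) :=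
  lintegral_map hf continuous_rot_toSpace.measurable

lemma revolveMeasure_mem_probOn {A : Set ℂ} (hA : IsCompact A) (hAH : A ⊆ rightHalfPlane)
    {ν : Measure ℂ} [IsProbabilityMeasure ν] (hν : ν Aᶜ = 0) :
    revolveMeasure ν ∈ probOn (revolve A) := by
  refine ⟨Measure.isProbabilityMeasure_map continuous_rot_toSpace.aemeasurable, ?_⟩
  rw [revolveMeasure, Measure.map_apply continuous_rot_toSpace.measurable
    (isCompact_revolve hA hAH).measurableSet.compl]
  have h : ∀ᵐ zt ∂(ν.prod angleMeasure), zt.1 ∈ A :=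
    Measure.quasiMeasurePreserving_fst.ae (show ∀ᵐ z ∂ν, z ∈ A from hν)
  refine measure_mono_null (fun zt hzt => ?_) (ae_iff.1 h)
  intro hA'
  refine hzt ?_
  rw [← profile_preimage hAH, mem_preimage, profile_rot_toSpace (hAH hA')]
  exact hA'

/-- The inner average over the angle does not depend on the angle of the outer point, so the spatial
potential is constant on orbits. This makes every measure on A a competitor in space. -/
lemma shiftedEnergy_revolveMeasure {R : ℝ} (hR : 0 < R) {A : Set ℂ}
    (hAR : ∀ z ∈ A, ‖z‖ ≤ R / 2) {ν : Measure ℂ} [IsProbabilityMeasure ν] (hν : ν Aᶜ = 0) :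
    shiftedEnergy R (revolveMeasure ν) = ringEnergy R ν := by
  have hνA : ∀ᵐ z ∂ν, z ∈ A := hν
  have hr := continuous_rot_toSpace
  have hinner : ∀ᵐ zt ∂(ν.prod angleMeasure),
      ∫⁻ q, shiftedLog R (edist (rot zt.2 (toSpace zt.1)) q) ∂(revolveMeasure ν) =
        ringPotential R ν zt.1 := by
    filter_upwards [Measure.quasiMeasurePreserving_fst.ae hνA] with zt hzt
    have hm : Measurable fun q => shiftedLog R (edist (rot zt.2 (toSpace zt.1)) q) :=
      (continuous_shiftedLog.comp (by fun_prop)).measurable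
    have hm2 : Measurable fun ws : ℂ × ℝ =>
        shiftedLog R (edist (rot zt.2 (toSpace zt.1)) (rot ws.2 (toSpace ws.1))) :=
      hm.comp hr.measurable
    rw [lintegral_revolveMeasure hm, lintegral_prod _ hm2.aemeasurable]
    refine lintegral_congr_ae (hνA.mono fun w hw => ?_)
    simp only
    rw [ringKernel_comm, ← lintegral_angleMeasure_shiftedLog_rot hR (hAR w hw) (hAR _ hzt) zt.2]
    refine lintegral_congr fun s => ?_
    rw [edist_comm]
  have : IsProbabilityMeasure (revolveMeasure ν) :=
    Measure.isProbabilityMeasure_map hr.aemeasurable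
  have hm : Measurable fun p => ∫⁻ q, shiftedLog R (edist p q) ∂(revolveMeasure ν) :=
    (measurable_shiftedLog_edist R).lintegral_prod_right'
  have hm2 : Measurable fun zt : ℂ × ℝ => ringPotential R ν zt.1 :=
    (measurable_ringPotential R ν).comp measurable_fst
  rw [shiftedEnergy, lintegral_revolveMeasure hm, lintegral_congr_ae hinner,
    lintegral_prod _ hm2.aemeasurable]
  simp [ringEnergy]

lemma lintegral_angleMeasure_shiftedLog_edist_rot {R : ℝ} (hR : 0 < R) {p q : Space}
    (hp : ‖p‖ ≤ R / 2) (hq : ‖q‖ ≤ R / 2) :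
    ∫⁻ t, shiftedLog R (edist (rot t p) q) ∂angleMeasure =
      ringKernel R (profile p) (profile q) := by
  obtain ⟨t₁, -, h₁⟩ := exists_rot_profile p
  obtain ⟨s, -, h₂⟩ := exists_rot_profile q
  rw [← norm_profile] at hp hq
  rw [← lintegral_angleMeasure_shiftedLog_rot hR hp hq (-t₁ + s)]
  refine lintegral_congr fun t => ?_
  conv_lhs => rw [h₁, h₂, rot_rot, ← edist_rot (-t₁), rot_rot, rot_rot]
  congr 4
  ring

/-- By invariance the first variable may be rotated by t for free; averaging over t and exchanging
integrals replaces the kernel by its rotational mean. -/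
lemma shiftedEnergy_eq_ringEnergy_map {R : ℝ} (hR : 0 < R) {A : Set ℂ} (hAH : A ⊆ rightHalfPlane)
    (hAR : ∀ z ∈ A, ‖z‖ ≤ R / 2) {μ : Measure Space} (hμ : μ ∈ probOn (revolve A))
    (hinv : ∀ t, μ.map (rot t) = μ) :
    shiftedEnergy R μ = ringEnergy R (μ.map profile) := by
  have := hμ.1
  have hμA : ∀ᵐ p ∂μ, ‖p‖ ≤ R / 2 := by
    have h : ∀ᵐ p ∂μ, p ∈ revolve A := hμ.2
    filter_upwards [h] with p hp
    rw [← profile_preimage hAH] at hp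
    rw [← norm_profile]
    exact hAR _ hp
  have hcont : Continuous fun x : (ℝ × Space) × Space => shiftedLog R (edist (rot x.1.1 x.1.2) x.2) := by
    have := continuous_rot_uncurry.comp (continuous_fst (X := ℝ × Space) (Y := Space))
    exact continuous_shiftedLog.comp (Continuous.edist this continuous_snd)
  have hstep : ∀ t, shiftedEnergy R μ =
      ∫⁻ p, ∫⁻ q, shiftedLog R (edist (rot t p) q) ∂μ ∂μ := by
    intro t
    have hm : Measurable fun p => ∫⁻ q, shiftedLog R (edist p q) ∂μ :=
      (measurable_shiftedLog_edist R).lintegral_prod_right'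
    conv_lhs => rw [shiftedEnergy]
    have h2 := lintegral_map (μ := μ) hm (continuous_rot t).measurable
    rw [hinv t] at h2
    exact h2
  calc shiftedEnergy R μ = ∫⁻ _t, shiftedEnergy R μ ∂angleMeasure := by simp
    _ = ∫⁻ t, ∫⁻ p, ∫⁻ q, shiftedLog R (edist (rot t p) q) ∂μ ∂μ ∂angleMeasure :=
        lintegral_congr hstep
    _ = ∫⁻ p, ∫⁻ t, ∫⁻ q, shiftedLog R (edist (rot t p) q) ∂μ ∂angleMeasure ∂μ :=
        lintegral_lintegral_swap (hcont.measurable.lintegral_prod_right').aemeasurable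
    _ = ∫⁻ p, ∫⁻ q, ∫⁻ t, shiftedLog R (edist (rot t p) q) ∂angleMeasure ∂μ ∂μ := by
        refine lintegral_congr fun p => lintegral_lintegral_swap ?_
        have : Continuous fun x : ℝ × Space => (((x.1, p), x.2) : (ℝ × Space) × Space) := by
          fun_prop
        exact (hcont.comp this).aemeasurable
    _ = ∫⁻ p, ∫⁻ q, ringKernel R (profile p) (profile q) ∂μ ∂μ := by
        refine lintegral_congr_ae (hμA.mono fun p hp => lintegral_congr_ae (hμA.mono fun q hq => ?_))
        exact lintegral_angleMeasure_shiftedLog_edist_rot hR hp hq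
    _ = ringEnergy R (μ.map profile) := by
        have := Measure.isProbabilityMeasure_map (μ := μ) measurable_profile.aemeasurable
        rw [ringEnergy, lintegral_map (measurable_ringPotential R _) measurable_profile]
        refine lintegral_congr fun p => ?_
        rw [ringPotential, lintegral_map (measurable_ringKernel_right R _) measurable_profile]

lemma map_rot_mem_probOn {A : Set ℂ} (hA : IsCompact A) (hAH : A ⊆ rightHalfPlane)
    {μ : Measure Space} (hμ : μ ∈ probOn (revolve A)) (t : ℝ) :
    μ.map (rot t) ∈ probOn (revolve A) := by
  have := hμ.1
  refine ⟨Measure.isProbabilityMeasure_map (continuous_rot t).aemeasurable, ?_⟩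
  rw [Measure.map_apply (continuous_rot t).measurable
    (isCompact_revolve hA hAH).measurableSet.compl, ← hμ.2]
  congr 1
  ext p
  rw [← profile_preimage hAH]
  simp [profile_rot]

lemma shiftedEnergy_map_rot (R : ℝ) (μ : Measure Space) [IsProbabilityMeasure μ] (t : ℝ) :
    shiftedEnergy R (μ.map (rot t)) = shiftedEnergy R μ := by
  have hr := (continuous_rot t).measurable
  have := Measure.isProbabilityMeasure_map (μ := μ) hr.aemeasurable
  rw [shiftedEnergy, lintegral_map
    ((measurable_shiftedLog_edist R).lintegral_prod_right') hr, shiftedEnergy]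
  refine lintegral_congr fun p => ?_
  have hm : Measurable fun q => shiftedLog R (edist (rot t p) q) :=
    (continuous_shiftedLog.comp (by fun_prop)).measurable
  change ∫⁻ q, shiftedLog R (edist (rot t p) q) ∂(μ.map (rot t)) = _
  rw [lintegral_map hm hr]
  simp_rw [edist_rot]

lemma edist_le_of_mem_revolve {R : ℝ} {A : Set ℂ} (hAH : A ⊆ rightHalfPlane)
    (hAR : ∀ z ∈ A, ‖z‖ ≤ R / 2) :
    ∀ p ∈ revolve A, ∀ q ∈ revolve A, edist p q ≤ ENNReal.ofReal R := by
  rw [← profile_preimage hAH]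
  intro p hp q hq
  have h1 := hAR _ hp
  have h2 := hAR _ hq
  rw [norm_profile] at h1 h2
  rw [edist_dist, dist_eq_norm]
  refine ENNReal.ofReal_le_ofReal ((norm_sub_le p q).trans ?_)
  linarith

lemma ringKernel_le {R : ℝ} {z w : ℂ} (hw : w ∈ rightHalfPlane) :
    ringKernel R z w ≤ shiftedLog R (ENNReal.ofReal (z.re / 2)) :=
  shiftedLog_antitone R (ENNReal.ofReal_le_ofReal (re_div_two_le_meanDist hw))

lemma ringKernel_ne_top {R : ℝ} (hR : 0 < R) {z w : ℂ} (hz : 0 < z.re) (hw : w ∈ rightHalfPlane) :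
    ringKernel R z w ≠ ⊤ :=
  ne_top_of_le_ne_top (shiftedLog_ofReal_ne_top (half_pos hz) hR) (ringKernel_le hw)

/-- Existence and uniqueness of the equilibrium measure of a set of revolution, and the
extremal property of its profile. -/
theorem existsUnique_isLogEquilibriumMeasure_revolve {R : ℝ} (hR : 1 ≤ R) {A : Set ℂ}
    (hA : IsCompact A) (hAH : A ⊆ rightHalfPlane) (hAR : ∀ z ∈ A, ‖z‖ ≤ R / 2)
    {z₀ : ℂ} (hz₀ : z₀ ∈ A) (hz₀re : 0 < z₀.re) :
    (∃! μ, IsLogEquilibriumMeasure (revolve A) μ) ∧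
      IsProbabilityMeasure (equilibriumMeasure A) ∧ equilibriumMeasure A Aᶜ = 0 ∧
      ringEnergy R (equilibriumMeasure A) ≠ ⊤ ∧
      ∀ ν : Measure ℂ, IsProbabilityMeasure ν → ν Aᶜ = 0 →
        ringEnergy R (equilibriumMeasure A) ≤ ringEnergy R ν := by
  have hR0 : 0 < R := by linarith
  have hB := edist_le_of_mem_revolve hAH hAR
  have hBc := isCompact_revolve hA hAH
  have hdirac : (Measure.dirac z₀ : Measure ℂ) Aᶜ = 0 := by
    rw [Measure.dirac_apply' _ hA.measurableSet.compl]
    simp [hz₀]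
  -- A point mass off the axis stands for a uniformly charged circle; its finite energy makes the
  -- minimum finite.
  have hfin : ringEnergy R (Measure.dirac z₀) ≠ ⊤ := by
    rw [ringEnergy, lintegral_dirac, ringPotential, lintegral_dirac]
    exact ringKernel_ne_top hR0 hz₀re (hAH hz₀)
  have hBne : (revolve A).Nonempty :=
    ⟨toSpace z₀, z₀, hz₀, 0, ⟨le_rfl, by positivity⟩, (rot_zero _).symm⟩
  have hmin : ∀ μ, IsLogEquilibriumMeasure (revolve A) μ → ∀ ν : Measure ℂ,
      IsProbabilityMeasure ν → ν Aᶜ = 0 → shiftedEnergy R μ ≤ ringEnergy R ν := by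
    intro μ hμ ν hν hνA
    rw [← shiftedEnergy_revolveMeasure hR0 hAR hνA]
    exact ((isLogEquilibriumMeasure_iff hR hB).1 hμ).2 _ (revolveMeasure_mem_probOn hA hAH hνA)
  have hfin' : ∀ μ, IsLogEquilibriumMeasure (revolve A) μ → shiftedEnergy R μ ≠ ⊤ := fun μ hμ =>
    ne_top_of_le_ne_top hfin (hmin μ hμ _ inferInstance hdirac)
  have huniq : ∀ μ ν, IsLogEquilibriumMeasure (revolve A) μ →
      IsLogEquilibriumMeasure (revolve A) ν → μ = ν := by
    intro μ ν hμ hν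
    have h1 := (isLogEquilibriumMeasure_iff hR hB).1 hμ
    have h2 := (isLogEquilibriumMeasure_iff hR hB).1 hν
    exact minimizer_shiftedEnergy_unique hR0 hB h1.1 h2.1 h1.2 h2.2 (hfin' μ hμ)
  have hex : ∃ μ, IsLogEquilibriumMeasure (revolve A) μ := by
    obtain ⟨μ, hμ, h⟩ := exists_minimizer_shiftedEnergy hR0 hBc hBne hB
    exact ⟨μ, (isLogEquilibriumMeasure_iff hR hB).2 ⟨hμ, h⟩⟩
  have hμ : IsLogEquilibriumMeasure (revolve A) (logEquilibriumMeasure (revolve A)) := by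
    rw [logEquilibriumMeasure, dif_pos hex]
    exact hex.choose_spec
  have hμ' := (isLogEquilibriumMeasure_iff hR hB).1 hμ
  have hprob := hμ'.1.1
  -- Every rotation of the minimizer is again a minimizer, so uniqueness gives invariance.
  have hinv : ∀ t, (logEquilibriumMeasure (revolve A)).map (rot t) =
      logEquilibriumMeasure (revolve A) := fun t =>
    huniq _ _ ((isLogEquilibriumMeasure_iff hR hB).2 ⟨map_rot_mem_probOn hA hAH hμ'.1 t, by
      rw [shiftedEnergy_map_rot]
      exact hμ'.2⟩) hμ
  have hE := shiftedEnergy_eq_ringEnergy_map hR0 hAH hAR hμ'.1 hinv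
  refine ⟨⟨_, hμ, fun ν hν => huniq ν _ hν hμ⟩,
    Measure.isProbabilityMeasure_map measurable_profile.aemeasurable, ?_, ?_, ?_⟩
  · rw [equilibriumMeasure, Measure.map_apply measurable_profile hA.measurableSet.compl,
      preimage_compl, profile_preimage hAH]
    exact hμ'.1.2
  · rw [equilibriumMeasure, ← hE]
    exact hfin' _ hμ
  · intro ν hν hνA
    rw [equilibriumMeasure, ← hE]
    exact hmin _ hμ ν hν hνA

end Revolution

namespace Revolution

open Filter Topology ComplexConjugate

/-! ### Monotonicity of the averaged kernel -/

/-- The function `meanDist · w` is convex and unchanged by the reflection z ↦ -conj z, which swaps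
its two distances; z₀ lies on the segment between z₁ and its mirror image. -/
lemma meanDist_mono {z₀ z₁ : ℂ} (w : ℂ) (h0 : 0 ≤ z₀.re) (hre : z₀.re ≤ z₁.re)
    (him : z₀.im = z₁.im) : meanDist z₀ w ≤ meanDist z₁ w := by
  rcases (h0.trans hre).eq_or_lt with h1 | h1
  · have : z₀ = z₁ := Complex.ext (by linarith) him
    rw [this]
  -- Solves c · Re z₁ - (1 - c) · Re z₁ = Re z₀.
  set c : ℝ := (z₁.re + z₀.re) / (2 * z₁.re) with hc
  have hc0 : 0 ≤ c := by positivity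
  have hc1 : 0 ≤ 1 - c := by
    rw [hc, sub_nonneg, div_le_one (by positivity)]
    linarith
  have hz : z₀ = c * z₁ + (1 - c : ℝ) * (-conj z₁) := by
    apply Complex.ext
    · have hcm : c * z₁.re * 2 = z₁.re + z₀.re := by
        rw [hc]
        field_simp
      simp only [Complex.add_re, Complex.re_ofReal_mul, Complex.neg_re, Complex.conj_re]
      linarith
    · simp only [Complex.add_im, Complex.im_ofReal_mul, Complex.neg_im, Complex.conj_im, him]
      ring
  have e1 : z₀ - w = c * (z₁ - w) + (1 - c : ℝ) * (-conj z₁ - w) := by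
    conv_lhs => rw [hz]
    push_cast; ring
  have e2 : z₀ + conj w = c * (z₁ + conj w) + (1 - c : ℝ) * (-conj z₁ + conj w) := by
    conv_lhs => rw [hz]
    push_cast; ring
  have n1 : ‖-conj z₁ - w‖ = ‖z₁ + conj w‖ := by
    rw [← Complex.norm_conj (z₁ + conj w), ← norm_neg]
    simp [add_comm]
  have n2 : ‖-conj z₁ + conj w‖ = ‖z₁ - w‖ := by
    rw [← Complex.norm_conj (z₁ - w), ← norm_neg]
    simp [add_comm, sub_eq_add_neg]
  have b1 := norm_add_le (c * (z₁ - w)) ((1 - c : ℝ) * (-conj z₁ - w))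
  have b2 := norm_add_le (c * (z₁ + conj w)) ((1 - c : ℝ) * (-conj z₁ + conj w))
  rw [← e1, norm_mul, norm_mul, Complex.norm_of_nonneg hc0, Complex.norm_of_nonneg hc1, n1] at b1
  rw [← e2, norm_mul, norm_mul, Complex.norm_of_nonneg hc0, Complex.norm_of_nonneg hc1, n2] at b2
  unfold meanDist
  linarith

lemma ringKernel_anti {R : ℝ} {z₀ z₁ : ℂ} (w : ℂ) (h0 : 0 ≤ z₀.re) (hre : z₀.re ≤ z₁.re)
    (him : z₀.im = z₁.im) : ringKernel R z₁ w ≤ ringKernel R z₀ w :=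
  shiftedLog_antitone R (ENNReal.ofReal_le_ofReal (meanDist_mono w h0 hre him))

/-- On a horizontal line `meanDist z₁ z₀` is just Re z₁, and `meanDist z₀ z₀` is Re z₀. The bound by
R keeps the truncation from hiding the strict inequality; z₀ may lie on the axis, where the value is
`⊤`. -/
lemma ringKernel_lt {R : ℝ} {z₀ z₁ : ℂ} (h0 : 0 ≤ z₀.re) (hre : z₀.re < z₁.re)
    (him : z₀.im = z₁.im) (hR : z₁.re ≤ R) : ringKernel R z₁ z₀ < ringKernel R z₀ z₀ := by
  have h1 : 0 < z₁.re := h0.trans_lt hre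
  have hR0 : 0 < R := h1.trans_le hR
  have e1 : meanDist z₁ z₀ = z₁.re := by
    have a1 : z₁ - z₀ = ((z₁.re - z₀.re : ℝ) : ℂ) := by apply Complex.ext <;> simp [him]
    have a2 : z₁ + conj z₀ = ((z₁.re + z₀.re : ℝ) : ℂ) := by apply Complex.ext <;> simp [him]
    rw [meanDist, a1, a2, Complex.norm_of_nonneg (by linarith), Complex.norm_of_nonneg (by linarith)]
    ring
  have e2 : meanDist z₀ z₀ = z₀.re := by
    have a2 : z₀ + conj z₀ = ((z₀.re + z₀.re : ℝ) : ℂ) := by apply Complex.ext <;> simp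
    rw [meanDist, a2, Complex.norm_of_nonneg (by linarith)]
    simp
  rw [ringKernel, ringKernel, e1, e2]
  rcases h0.eq_or_lt with h | h
  · rw [← h, ENNReal.ofReal_zero, shiftedLog_zero hR0]
    exact lt_top_iff_ne_top.2 (shiftedLog_ofReal_ne_top h1 hR0)
  · rw [shiftedLog_ofReal h1 hR0, shiftedLog_ofReal h hR0, ENNReal.ofReal_lt_ofReal_iff]
    · exact Real.log_lt_log (by positivity) (by gcongr)
    · exact Real.log_pos ((one_lt_div h).2 (by linarith))

/-! ### The potential of a minimizer -/

lemma ringPotential_ne_top {R : ℝ} (hR : 0 < R) {ν : Measure ℂ} [IsFiniteMeasure ν]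
    (hν : ∀ᵐ w ∂ν, w ∈ rightHalfPlane) {z : ℂ} (hz : 0 < z.re) : ringPotential R ν z ≠ ⊤ := by
  refine ne_top_of_le_ne_top (b := shiftedLog R (ENNReal.ofReal (z.re / 2)) * ν univ)
    (ENNReal.mul_ne_top (shiftedLog_ofReal_ne_top (half_pos hz) hR) (measure_ne_top _ _)) ?_
  rw [← lintegral_const]
  exact lintegral_mono_ae (hν.mono fun w hw => ringKernel_le hw)

lemma continuous_ringKernel_left (R : ℝ) (w : ℂ) : Continuous fun z => ringKernel R z w := by
  have : Continuous fun z => meanDist z w := by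
    unfold meanDist
    fun_prop
  exact continuous_shiftedLog.comp (ENNReal.continuous_ofReal.comp this)

/-- Lower semicontinuity of the potential, by Fatou along the neighbourhood filter. -/
lemma eventually_lt_ringPotential {R : ℝ} {ν : Measure ℂ} {z₀ : ℂ} {c : ENNReal}
    (h : c < ringPotential R ν z₀) : ∀ᶠ z in 𝓝 z₀, c < ringPotential R ν z := by
  have h1 : ∫⁻ w, liminf (fun z => ringKernel R z w) (𝓝 z₀) ∂ν ≤
      liminf (fun z => ringPotential R ν z) (𝓝 z₀) :=
    lintegral_liminf_le (measurable_ringKernel_right R)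
  have h2 : ringPotential R ν z₀ = ∫⁻ w, liminf (fun z => ringKernel R z w) (𝓝 z₀) ∂ν := by
    refine lintegral_congr fun w => ?_
    exact ((continuous_ringKernel_left R w).tendsto z₀).liminf_eq.symm
  rw [h2] at h
  exact eventually_lt_of_lt_liminf (h.trans_le h1)

lemma ringPotential_add_smul (R : ℝ) (ν ρ : Measure ℂ) (a b : ENNReal) (z : ℂ) :
    ringPotential R (a • ν + b • ρ) z = a * ringPotential R ν z + b * ringPotential R ρ z := by
  simp [ringPotential, lintegral_add_measure, lintegral_smul_measure]

/-- The first-order condition satisfied by a measure of least energy. -/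
lemma ringEnergy_le_ringPotential {R : ℝ} (hR : 0 < R) {A : Set ℂ} (hA : IsCompact A)
    (hAH : A ⊆ rightHalfPlane)
    {ν : Measure ℂ} [IsProbabilityMeasure ν] (hνA : ν Aᶜ = 0) (hfin : ringEnergy R ν ≠ ⊤)
    (hmin : ∀ ρ : Measure ℂ, IsProbabilityMeasure ρ → ρ Aᶜ = 0 → ringEnergy R ν ≤ ringEnergy R ρ)
    {z : ℂ} (hz : z ∈ A) (hzre : 0 < z.re) : ringEnergy R ν ≤ ringPotential R ν z := by
  have hνH : ∀ᵐ w ∂ν, w ∈ rightHalfPlane :=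
    (show ∀ᵐ w ∂ν, w ∈ A from hνA).mono fun w hw => hAH hw
  have hU := ringPotential_ne_top hR hνH hzre
  have hκ := ringKernel_ne_top hR hzre (hAH hz)
  -- Compare ν with (1 - ε)ν + εδ_z, whose energy is finite because z is off the axis.
  have hvar : ∀ ε : ℝ, 0 < ε → ε < 1 → (ringEnergy R ν).toReal ≤
      (1 - ε) ^ 2 * (ringEnergy R ν).toReal + 2 * ε * (1 - ε) * (ringPotential R ν z).toReal +
        ε ^ 2 * (ringKernel R z z).toReal := by
    intro ε h0 h1
    set a := ENNReal.ofReal (1 - ε) with ha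
    set b := ENNReal.ofReal ε with hb
    set ρ : Measure ℂ := a • ν + b • Measure.dirac z with hρ
    have hab : a + b = 1 := by
      rw [ha, hb, ← ENNReal.ofReal_add (by linarith) h0.le]; simp
    have hρp : IsProbabilityMeasure ρ := ⟨by simp [hρ, hab]⟩
    have hρA : ρ Aᶜ = 0 := by
      simp [hρ, hνA, Measure.dirac_apply' _ hA.measurableSet.compl, hz]
    have hdir : ∀ x, ringPotential R (Measure.dirac z) x = ringKernel R z x := fun x => by
      rw [ringPotential, lintegral_dirac, ringKernel_comm]
    have hE : ringEnergy R ρ = a * (a * ringEnergy R ν + b * ringPotential R ν z) +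
        b * (a * ringPotential R ν z + b * ringKernel R z z) := by
      have hm := measurable_ringPotential R ν
      have hm2 := measurable_ringKernel_right R z
      rw [ringEnergy]
      simp_rw [hρ, ringPotential_add_smul, hdir]
      rw [lintegral_add_measure, lintegral_smul_measure, lintegral_smul_measure, lintegral_dirac,
        lintegral_add_left (hm.const_mul _), lintegral_const_mul _ hm, lintegral_const_mul _ hm2]
      rfl
    have hle := hmin ρ hρp hρA
    rw [hE] at hle
    have hle' := ENNReal.toReal_mono (by finiteness) hle
    rw [ENNReal.toReal_add (by finiteness) (by finiteness), ENNReal.toReal_mul,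
      ENNReal.toReal_mul, ENNReal.toReal_add (by finiteness) (by finiteness),
      ENNReal.toReal_add (by finiteness) (by finiteness), ENNReal.toReal_mul, ENNReal.toReal_mul,
      ENNReal.toReal_mul, ENNReal.toReal_mul, ha, hb, ENNReal.toReal_ofReal (by linarith),
      ENNReal.toReal_ofReal h0.le] at hle'
    linarith
  rw [← ENNReal.toReal_le_toReal hfin hU]
  set F := (ringEnergy R ν).toReal
  set U := (ringPotential R ν z).toReal
  set k := (ringKernel R z z).toReal
  by_contra! hlt
  -- The variation reads 0 ≤ ε(-2(F - U) + ε(F - 2U + k)); choosing ε with εM ≤ F - U makes the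
  -- bracket at most -(F - U) < 0.
  set M := |F - 2 * U + k| + 1 with hM
  have hMpos : 0 < M := by positivity
  have hc : 0 < F - U := by linarith
  set ε := min (1 / 2) ((F - U) / M) with hε
  have hε0 : 0 < ε := lt_min (by norm_num) (by positivity)
  have hε1 : ε < 1 := (min_le_left _ _).trans_lt (by norm_num)
  have hεM : ε * M ≤ F - U := by
    rw [← le_div_iff₀ hMpos]; exact min_le_right _ _
  have h1 := hvar ε hε0 hε1
  have h2 : F - 2 * U + k ≤ M := by linarith [le_abs_self (F - 2 * U + k)]
  have h3 : ε * (F - 2 * U + k) ≤ F - U := (mul_le_mul_of_nonneg_left h2 hε0.le).trans hεM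
  have h4 : 0 ≤ ε * (-2 * (F - U) + ε * (F - 2 * U + k)) := by linarith
  have h5 := nonneg_of_mul_nonneg_right h4 hε0
  linarith

end Revolution

namespace Revolution

open Filter Topology ComplexConjugate

/-! ### The support of a minimizer -/

lemma exists_rightmost {A : Set ℂ} (hA : IsCompact A) {z : ℂ} (hz : z ∈ A) :
    ∃ z₁ ∈ rightmost A, z₁.im = z.im ∧ z.re ≤ z₁.re := by
  have hc : IsCompact {x : ℝ | (⟨x, z.im⟩ : ℂ) ∈ A} := by
    have h : {x : ℝ | (⟨x, z.im⟩ : ℂ) ∈ A} = Complex.re '' (A ∩ {w | w.im = z.im}) := by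
      ext x
      constructor
      · intro hx
        exact ⟨⟨x, z.im⟩, ⟨hx, rfl⟩, rfl⟩
      · rintro ⟨w, ⟨hw, him⟩, rfl⟩
        have him : w.im = z.im := him
        show (⟨w.re, z.im⟩ : ℂ) ∈ A
        rw [← him]
        exact hw
    rw [h]
    exact (hA.inter_right (isClosed_eq Complex.continuous_im continuous_const)).image
      Complex.continuous_re
  obtain ⟨x, hx⟩ := hc.exists_isGreatest ⟨z.re, hz⟩
  exact ⟨⟨x, z.im⟩, hx, rfl, hx.2 hz⟩

lemma rightmost_subset (A : Set ℂ) : rightmost A ⊆ A := fun _ hz => hz.1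

lemma re_pos_of_mem_interior {z : ℂ} (hz : z ∈ interior rightHalfPlane) : 0 < z.re := by
  have h : rightHalfPlane = {z : ℂ | 0 ≤ z.re} := rfl
  rwa [h, Complex.interior_setOfPred_le_re] at hz

/-- The properties of the potential of a measure of least energy: its support lies in the
right-most part, where the potential is at least the energy, with equality on the support. -/
lemma support_subset_rightmost {R : ℝ} (hR : 0 < R) {A : Set ℂ} (hA : IsCompact A)
    (hAH : A ⊆ rightHalfPlane) (hAR : ∀ z ∈ A, ‖z‖ ≤ R / 2)
    (hAint : rightmost A ⊆ interior rightHalfPlane)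
    {ν : Measure ℂ} [IsProbabilityMeasure ν] (hνA : ν Aᶜ = 0) (hfin : ringEnergy R ν ≠ ⊤)
    (hmin : ∀ ρ : Measure ℂ, IsProbabilityMeasure ρ → ρ Aᶜ = 0 → ringEnergy R ν ≤ ringEnergy R ρ) :
    ν.support ⊆ rightmost A ∧ (∀ z ∈ A, ringEnergy R ν ≤ ringPotential R ν z) ∧
      ∀ z ∈ ν.support, ringPotential R ν z ≤ ringEnergy R ν := by
  have hνae : ∀ᵐ w ∂ν, w ∈ A := hνA
  have hνH : ∀ᵐ w ∂ν, w ∈ rightHalfPlane := hνae.mono fun w hw => hAH hw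
  have hpos : ∀ z ∈ rightmost A, 0 < z.re := fun z hz => re_pos_of_mem_interior (hAint hz)
  -- The point-mass variation needs a point off the axis, so it is applied at the right end of the
  -- slice, where the potential is no larger.
  have hlow : ∀ z ∈ A, ringEnergy R ν ≤ ringPotential R ν z := by
    intro z hz
    obtain ⟨z₁, hz₁, him, hre⟩ := exists_rightmost hA hz
    exact (ringEnergy_le_ringPotential hR hA hAH hνA hfin hmin (rightmost_subset A hz₁)
      (hpos _ hz₁)).trans (lintegral_mono fun w => ringKernel_anti w (hAH hz) hre him.symm)
  -- The potential is at least F almost everywhere and integrates to F.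
  have hae : (fun _ => ringEnergy R ν) =ᵐ[ν] ringPotential R ν := by
    refine ae_eq_of_ae_le_of_lintegral_le (hνae.mono hlow) (by simpa using hfin)
      (measurable_ringPotential R ν).aemeasurable ?_
    simp [ringEnergy]
  have hup : ∀ z ∈ ν.support, ringPotential R ν z ≤ ringEnergy R ν := by
    intro z hz
    by_contra! hlt
    -- Strict excess would persist on a neighbourhood of z, which has positive mass, against the
    -- almost everywhere equality.
    have h1 := eventually_lt_ringPotential hlt
    have h2 := (Measure.mem_support_iff_forall z).1 hz _ h1
    refine h2.ne' (measure_mono_null (fun w hw => ?_) (ae_iff.1 hae))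
    exact ne_of_lt hw
  have hsuppA : ν.support ⊆ A := Measure.support_subset_of_isClosed hA.isClosed hνae
  refine ⟨fun z hz => ?_, hlow, hup⟩
  obtain ⟨z₁, hz₁, him, hre⟩ := exists_rightmost hA (hsuppA hz)
  rcases hre.eq_or_lt with h | h
  · rwa [Complex.ext h him.symm]
  exfalso
  have h0 : 0 ≤ z.re := hAH (hsuppA hz)
  have hz₁A := rightmost_subset A hz₁
  have hz₁R : z₁.re ≤ R := by
    have h1 := hAR _ hz₁A
    have h2 := Complex.re_le_norm z₁
    linarith
  -- The kernel drops strictly at w = z, hence for w near z by continuity, and ν charges that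
  -- neighbourhood.
  have hlt : ringPotential R ν z₁ < ringPotential R ν z := by
    refine lintegral_strict_mono_of_ae_le_of_ae_lt_on
      (measurable_ringKernel_right R z).aemeasurable (ringPotential_ne_top hR hνH (hpos _ hz₁))
      (ae_of_all _ fun w => ringKernel_anti w h0 h.le him.symm)
      (s := {w | ringKernel R z₁ w < ringKernel R z w}) ?_ (ae_of_all _ fun w hw => hw)
    have hc : ∀ x, Continuous (ringKernel R x) := fun x => by
      have h3 := continuous_ringKernel_left R x
      simp_rw [ringKernel_comm R _ x] at h3
      exact h3
    have ho : IsOpen {w | ringKernel R z₁ w < ringKernel R z w} := isOpen_lt (hc z₁) (hc z)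
    exact ((Measure.mem_support_iff_forall z).1 hz _
      (ho.mem_nhds (ringKernel_lt h0 h him.symm hz₁R))).ne'
  exact absurd (hlow z₁ hz₁A) (not_le.2 (hlt.trans_le (hup z hz)))

/-- Strict convexity of the kernel, in terms of the shifted kernel. -/
lemma ringKernel_lt_of_K_lt {R : ℝ} (hR : 1 ≤ R) {z z₁ z₂ w : ℂ} (hz : ‖z‖ ≤ R / 2)
    (hz₁ : ‖z₁‖ ≤ R / 2) (hz₂ : ‖z₂‖ ≤ R / 2) (hw : ‖w‖ ≤ R / 2) (hwH : w ∈ rightHalfPlane)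
    (p : 0 < z.re) (p₁ : 0 < z₁.re) (p₂ : 0 < z₂.re) {θ : ℝ} (hθ0 : 0 < θ) (hθ1 : θ < 1)
    (h : K z w < (θ : EReal) * K z₁ w + ((1 - θ : ℝ) : EReal) * K z₂ w) :
    ringKernel R z w <
      ENNReal.ofReal θ * ringKernel R z₁ w + ENNReal.ofReal (1 - θ) * ringKernel R z₂ w := by
  have hR0 : 0 < R := by linarith
  rw [K_eq_ringKernel_sub hR hz hw, K_eq_ringKernel_sub hR hz₁ hw,
    K_eq_ringKernel_sub hR hz₂ hw] at h
  have f := ringKernel_ne_top hR0 p hwH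
  have f₁ := ringKernel_ne_top hR0 p₁ hwH
  have f₂ := ringKernel_ne_top hR0 p₂ hwH
  have e : ∀ x : ENNReal, x ≠ ⊤ → (x : EReal) = ((x.toReal : ℝ) : EReal) := fun x hx => by
    lift x to NNReal using hx
    rw [EReal.coe_nnreal_eq_coe_real, ENNReal.coe_toReal]
  rw [e _ f, e _ f₁, e _ f₂, ← EReal.coe_sub, ← EReal.coe_sub, ← EReal.coe_sub, ← EReal.coe_mul,
    ← EReal.coe_mul, ← EReal.coe_add, EReal.coe_lt_coe_iff] at h
  rw [← ENNReal.toReal_lt_toReal f (by finiteness), ENNReal.toReal_add (by finiteness)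
    (by finiteness), ENNReal.toReal_mul, ENNReal.toReal_mul, ENNReal.toReal_ofReal hθ0.le,
    ENNReal.toReal_ofReal (by linarith)]
  linarith

/-- A gap argument: between two consecutive parameters of the support the potential along γ is
strictly below its chord, hence below the energy, so no point of A₊ can sit there. -/
lemma exists_support_eq {R : ℝ} (hR : 1 ≤ R) {A : Set ℂ} (hA : IsCompact A)
    (hAH : A ⊆ rightHalfPlane) (hAR : ∀ z ∈ A, ‖z‖ ≤ R / 2)
    (hAint : rightmost A ⊆ interior rightHalfPlane)
    {a b : ℝ} {γ : ℝ → ℂ} (hγ : ContinuousOn γ (Icc a b)) (hcover : rightmost A ⊆ γ '' Icc a b)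
    (hconv : ∀ s ∈ Icc a b, StrictlyConvexOnIcc (fun t => K (γ t) (γ s)) a s ∧
      StrictlyConvexOnIcc (fun t => K (γ t) (γ s)) s b)
    {ν : Measure ℂ} [IsProbabilityMeasure ν] (hνA : ν Aᶜ = 0) (hfin : ringEnergy R ν ≠ ⊤)
    (hmin : ∀ ρ : Measure ℂ, IsProbabilityMeasure ρ → ρ Aᶜ = 0 → ringEnergy R ν ≤ ringEnergy R ρ) :
    ∃ c d : ℝ, a ≤ c ∧ c ≤ d ∧ d ≤ b ∧ ν.support = γ '' Icc c d ∩ rightmost A := by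
  have hR0 : 0 < R := by linarith
  obtain ⟨hsub, hlow, hup⟩ := support_subset_rightmost hR0 hA hAH hAR hAint hνA hfin hmin
  have hpos : ∀ z ∈ rightmost A, 0 < z.re := fun z hz => re_pos_of_mem_interior (hAint hz)
  have hrA := rightmost_subset A
  -- All parameters of support points; γ may pass through such a point several times.
  set T : Set ℝ := Icc a b ∩ γ ⁻¹' ν.support with hT
  have hTc : IsCompact T :=
    isCompact_Icc.of_isClosed_subset (hγ.preimage_isClosed_of_isClosed isClosed_Icc
      Measure.isClosed_support) inter_subset_left
  have hpre : ∀ w ∈ ν.support, ∃ s ∈ T, γ s = w := by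
    intro w hw
    obtain ⟨s, hs, rfl⟩ := hcover (hsub hw)
    exact ⟨s, ⟨hs, hw⟩, rfl⟩
  have hTne : T.Nonempty := by
    obtain ⟨w, hw⟩ := Measure.nonempty_support (IsProbabilityMeasure.ne_zero ν)
    obtain ⟨s, hs, -⟩ := hpre w hw
    exact ⟨s, hs⟩
  obtain ⟨c, hc⟩ := hTc.exists_isLeast hTne
  obtain ⟨d, hd⟩ := hTc.exists_isGreatest hTne
  refine ⟨c, d, hc.1.1.1, hc.2 hd.1, hd.1.1.2, Subset.antisymm (fun w hw => ?_) ?_⟩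
  · obtain ⟨s, hs, rfl⟩ := hpre w hw
    exact ⟨⟨s, ⟨hc.2 hs, hd.2 hs⟩, rfl⟩, hsub hw⟩
  rintro _ ⟨⟨t, ht, rfl⟩, htA⟩
  by_contra hnot
  have htT : t ∉ T := fun h => hnot h.2
  obtain ⟨α, hα⟩ := (hTc.inter_right isClosed_Iic).exists_isGreatest
    (⟨c, hc.1, ht.1⟩ : (T ∩ Iic t).Nonempty)
  obtain ⟨β, hβ⟩ := (hTc.inter_right isClosed_Ici).exists_isLeast
    (⟨d, hd.1, ht.2⟩ : (T ∩ Ici t).Nonempty)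
  have hαt : α < t := lt_of_le_of_ne hα.1.2 fun h => htT (h ▸ hα.1.1)
  have htβ : t < β := lt_of_le_of_ne hβ.1.2 fun h => htT (h ▸ hβ.1.1)
  have hαβ : 0 < β - α := by linarith
  set θ : ℝ := (β - t) / (β - α) with hθ
  have hθ0 : 0 < θ := div_pos (by linarith) hαβ
  have hθ1 : θ < 1 := (div_lt_one hαβ).2 (by linarith)
  have htθ : θ * α + (1 - θ) * β = t := by
    rw [hθ]
    field_simp
    ring
  have hαr := hsub hα.1.1.2
  have hβr := hsub hβ.1.1.2
  have hlt : ∀ w ∈ ν.support, ringKernel R (γ t) w <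
      ENNReal.ofReal θ * ringKernel R (γ α) w + ENNReal.ofReal (1 - θ) * ringKernel R (γ β) w := by
    intro w hw
    obtain ⟨s, hs, rfl⟩ := hpre w hw
    have hwA := hrA (hsub hw)
    refine ringKernel_lt_of_K_lt hR (hAR _ (hrA htA)) (hAR _ (hrA hαr)) (hAR _ (hrA hβr))
      (hAR _ hwA) (hAH hwA) (hpos _ htA) (hpos _ hαr) (hpos _ hβr) hθ0 hθ1 ?_
    -- No parameter in T lies strictly between α and β, so s ≤ t forces s ≤ α and t ≤ s forces β ≤
    -- s; either way [α, β] lies on one side of s.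
    rcases le_total s t with hst | hst
    · have := (hconv s hs.1).2 α β θ (hα.2 ⟨hs, hst⟩) (by linarith) hβ.1.1.1.2 hθ0 hθ1
      rwa [htθ] at this
    · have := (hconv s hs.1).1 α β θ hα.1.1.1.1 (by linarith) (hβ.2 ⟨hs, hst⟩) hθ0 hθ1
      rwa [htθ] at this
  have hsupp : ∀ᵐ w ∂ν, w ∈ ν.support := Measure.support_mem_ae
  have hνH : ∀ᵐ w ∂ν, w ∈ rightHalfPlane :=
    (show ∀ᵐ w ∂ν, w ∈ A from hνA).mono fun w hw => hAH hw
  have m := measurable_ringKernel_right R (γ α)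
  have m' := measurable_ringKernel_right R (γ β)
  have hint : ringPotential R ν (γ t) <
      ENNReal.ofReal θ * ringPotential R ν (γ α) + ENNReal.ofReal (1 - θ) * ringPotential R ν (γ β) := by
    have h1 : ∫⁻ w, ringKernel R (γ t) w ∂ν < ∫⁻ w, (ENNReal.ofReal θ * ringKernel R (γ α) w +
        ENNReal.ofReal (1 - θ) * ringKernel R (γ β) w) ∂ν :=
      lintegral_strict_mono (IsProbabilityMeasure.ne_zero ν) (by fun_prop)
        (ringPotential_ne_top hR0 hνH (hpos _ htA)) (hsupp.mono hlt)
    rwa [lintegral_add_left (m.const_mul _), lintegral_const_mul _ m, lintegral_const_mul _ m'] at h1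
  have hle : ENNReal.ofReal θ * ringPotential R ν (γ α) +
      ENNReal.ofReal (1 - θ) * ringPotential R ν (γ β) ≤ ringEnergy R ν := by
    calc _ ≤ ENNReal.ofReal θ * ringEnergy R ν + ENNReal.ofReal (1 - θ) * ringEnergy R ν := by
          gcongr
          · exact hup _ hα.1.1.2
          · exact hup _ hβ.1.1.2
      _ = ringEnergy R ν := by
          rw [← add_mul, ← ENNReal.ofReal_add hθ0.le (by linarith)]
          simp
  exact absurd (hlow _ (hrA htA)) (not_le.2 (hint.trans_le hle))

end Revolution

theorem mainTheorem6 (A : Set ℂ) (hA : IsCompact A) (hAne : A.Nonempty)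
    (hAH : A ⊆ Revolution.rightHalfPlane)
    (hAint : Revolution.rightmost A ⊆ interior Revolution.rightHalfPlane)
    (a b : ℝ) (γ : ℝ → ℂ) (hγ : ContinuousOn γ (Set.Icc a b))
    (hγH : Set.MapsTo γ (Set.Icc a b) Revolution.rightHalfPlane)
    (hcover : Revolution.rightmost A ⊆ γ '' Set.Icc a b)
    (hconv : ∀ s ∈ Set.Icc a b,
      Revolution.StrictlyConvexOnIcc (fun t => Revolution.K (γ t) (γ s)) a s ∧
      Revolution.StrictlyConvexOnIcc (fun t => Revolution.K (γ t) (γ s)) s b) :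
    (∃! μ : MeasureTheory.Measure Revolution.Space,
      Revolution.IsLogEquilibriumMeasure (Revolution.revolve A) μ) ∧
    ∃ c d : ℝ, a ≤ c ∧ c ≤ d ∧ d ≤ b ∧
      (Revolution.equilibriumMeasure A).support =
        γ '' Set.Icc c d ∩ Revolution.rightmost A := by
  obtain ⟨C, hC⟩ := hA.isBounded.exists_norm_le
  -- R bounds the diameter of the set of revolution, and R ≥ 1 gives log R ≥ 0, as the shift of the
  -- kernel requires.
  set R : ℝ := max 1 (2 * C) with hRdef
  have hR : 1 ≤ R := le_max_left _ _
  have hAR : ∀ z ∈ A, ‖z‖ ≤ R / 2 := fun z hz => by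
    have h1 := hC z hz
    have h2 : 2 * C ≤ R := le_max_right _ _
    linarith
  obtain ⟨z, hz⟩ := hAne
  obtain ⟨z₀, hz₀, -⟩ := Revolution.exists_rightmost hA hz
  obtain ⟨hex, hprob, hnull, hfin, hmin⟩ :=
    Revolution.existsUnique_isLogEquilibriumMeasure_revolve hR hA hAH hAR
      (Revolution.rightmost_subset A hz₀) (Revolution.re_pos_of_mem_interior (hAint hz₀))
  exact ⟨hex, Revolution.exists_support_eq hR hA hAH hAR hAint hγ hcover hconv hnull hfin hmin⟩
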